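/- **Theorem 2 (convergence of the CN-4FCD scheme).** Let $d\ge 1$, $\Omega=\prod_{i=1}^d(\check a_i,\hat a_i)\subset\mathbb R^d$ a bounded box, $T>0$, $\alpha_i\in(1,2)$, $K_i>0$, and let $r$ satisfy $0<\check r\le r(x,t)\le\hat r$ on $\Omega\times(0,T]$. Let $U$ be a classical solution, continuous on $\overline\Omega\times[0,T]$, of $$r(x,t)\,\partial_t U=\sum_{i=1}^d K_i\frac{\partial^{\alpha_i}U}{\partial|x_i|^{\alpha_i}}+f(x,t)\ \text{ in }\Omega\times(0,T],\qquad U=0\ \text{ on }\partial\Omega\times[0,T],\qquad U(\cdot,0)=\psi\ \text{ in }\Omega,$$ where $$\frac{\partial^{\alpha_i}U}{\partial|x_i|^{\alpha_i}}(x,t)=-\frac{1}{2\cos(\alpha_i\pi/2)\,\Gamma(2-\alpha_i)}\,\frac{\partial^2}{\partial x_i^2}\int_{\check a_i}^{\hat a_i}\frac{U(x_1,\dots,x_{i-1},\eta,x_{i+1},\dots,x_d,t)}{|x_i-\eta|^{\alpha_i-1}}\,d\eta .$$ Assume that $U$ is regular in the following sense: 1. for every $x\in\Omega$ the map $t\mapsto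 U(x,t)$ is $C^3$ on $[0,T]$, and $\partial_t^3U$ is bounded on $\Omega\times[0,T]$; 2. for every $x\in\Omega$ the map $t\mapsto \sum_i K_i\,\partial^{\alpha_i}U/\partial|x_i|^{\alpha_i}(x,t)$ is $C^2$ on $[0,T]$, with second derivative bounded on $\Omega\times[0,T]$; 3. for every $i$, every $t\in[0,T]$ and every line through a point of $\Omega$ parallel to the $i$-th axis, the restriction $v$ to that line of the extension of $U(\cdot,t)$ by zero outside $\Omega$ belongs to $L^1(\mathbb R)$ and satisfies $\int_{\mathbb R}(1+|\eta|)^{4+\alpha_i}|\hat v(\eta)|\,d\eta\le B$, with $\hat v$ the Fourier transform of $v$ and $B$ independent of $i$, $t$ and the line. For integers $n_i\ge1$ and $M\ge1$ put $h_i=(\hat a_i-\check a_i)/(n_i+1)$, $\Delta t=T/M$, $t_m=m\Delta t$, $t_{m+1/2}=(m+\frac12)\Delta t$, $\mathbb L=\prod_i\{1,\dots,n_i\}$ and $x_J=(\check a_i+j_ih_i)_{i}$ for $J=(j_1,\dots,j_d)\in\mathbb Z^d$. Let $s^{(\alpha)}_k$, $k\in\mathbb Z$, be the Fourier coefficients of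 $S^{(\alpha)}(e^{\mathbf i\theta})$, where $$S^{(\alpha)}(\omega)=\Big[1+\tfrac{\alpha}{24}(2-\omega-\omega^{-1})\Big](2-\omega-\omega^{-1})^{\alpha/2}=\sum_{k\in\mathbb Z}s^{(\alpha)}_k\omega^k,\qquad|\omega|=1,$$ and for a grid function $v:\mathbb Z^d\to\mathbb R$ vanishing outside $\mathbb L$ let $$\delta_{x_i}^{\alpha_i}v_J=-h_i^{-\alpha_i}\sum_{k\in\mathbb Z}s_k^{(\alpha_i)}v_{(j_1,\dots,j_i-k,\dots,j_d)} .$$ Let the grid functions $u^0,\dots,u^M$, vanishing outside $\mathbb L$, solve the CN-4FCD scheme: $u^0_J=\psi(x_J)$ and $$r(x_J,t_{m+\frac12})\frac{u_J^{m+1}-u_J^m}{\Delta t}=\sum_{i=1}^dK_i\,\delta_{x_i}^{\alpha_i}\frac{u_J^{m+1}+u_J^m}{2}+f(x_J,t_{m+\frac12}),\qquad J\in\mathbb L,\ 0\le m\le M-1 .$$ Write $U^m_J=U(x_J,t_m)$ and $\|v\|=\big(\prod_{i}h_i\sum_{J\in\mathbb L}|v_J|^2\big)^{1/2}$ for the discrete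 $L^2$-norm. Then there is a constant $C_1>0$, independent of all step sizes $h_i$ and $\Delta t$, such that for all $n_1,\dots,n_d\ge1$, all $M\ge1$ and all $m=0,\dots,M-1$ $$\|u^{m+1}-U^{m+1}\|\le C_1\big(\Delta t^2+h_1^4+\dots+h_d^4\big);$$ in particular there is no restriction on the spatial steps. -/

import Mathlib

/-- Data of the initial-boundary value problem
`r(x,t) ∂ₜu = ∑ i, K i * ∂^{α i} u / ∂|x i|^{α i} + f(x,t)` in `Ω × (0,T]`, `u = 0` on `∂Ω`,
`u(x,0) = ψ(x)`, on the box `Ω = ∏ i, (a i, b i)` in dimension `d ≥ 1`. -/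
structure RieszProblem (d : ℕ) where
  dim_pos : 1 ≤ d
  /-- left end points of the box -/
  a : Fin d → ℝ
  /-- right end points of the box -/
  b : Fin d → ℝ
  a_lt_b : ∀ i, a i < b i
  /-- orders of the Riesz derivatives -/
  α : Fin d → ℝ
  α_mem : ∀ i, α i ∈ Set.Ioo (1 : ℝ) 2
  /-- diffusion coefficients -/
  K : Fin d → ℝ
  K_pos : ∀ i, 0 < K i
  /-- final time -/
  T : ℝ
  T_pos : 0 < T
  /-- variable coefficient in front of the time derivative -/
  r : (Fin d → ℝ) → ℝ → ℝ
  /-- lower bound of `r` -/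
  rmin : ℝ
  /-- upper bound of `r` -/
  rmax : ℝ
  rmin_pos : 0 < rmin
  r_bounds : ∀ x ∈ Set.univ.pi (fun i => Set.Ioo (a i) (b i)), ∀ t ∈ Set.Ioc 0 T,
    rmin ≤ r x t ∧ r x t ≤ rmax
  /-- source term -/
  f : (Fin d → ℝ) → ℝ → ℝ
  /-- initial value -/
  ψ : (Fin d → ℝ) → ℝ

namespace RieszProblem

noncomputable section

/-- The open box `Ω`. -/
def Ω {d : ℕ} (P : RieszProblem d) : Set (Fin d → ℝ) :=
  Set.univ.pi fun i => Set.Ioo (P.a i) (P.b i)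

/-! ### The continuous problem -/

/-- `s ↦ ∫_{a i}^{b i} w(x₁,…,x_{i-1},η,x_{i+1},…,x_d) / |s - η|^{α i - 1} dη`. -/
def rieszPotential {d : ℕ} (P : RieszProblem d) (i : Fin d) (w : (Fin d → ℝ) → ℝ)
    (x : Fin d → ℝ) (s : ℝ) : ℝ :=
  ∫ η in (P.a i)..(P.b i), w (Function.update x i η) / |s - η| ^ (P.α i - 1)

/-- The Riesz fractional derivative `∂^{α i} w / ∂|x i|^{α i}` at the point `x`. -/
def rieszDeriv {d : ℕ} (P : RieszProblem d) (i : Fin d) (w : (Fin d → ℝ) → ℝ)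
    (x : Fin d → ℝ) : ℝ :=
  -(1 / (2 * Real.cos (P.α i * Real.pi / 2) * Real.Gamma (2 - P.α i))) *
    deriv (deriv (P.rieszPotential i w x)) (x i)

/-- The spatial operator `∑ i, K i * ∂^{α i} w / ∂|x i|^{α i}` at the point `x`. -/
def spatialOp {d : ℕ} (P : RieszProblem d) (w : (Fin d → ℝ) → ℝ) (x : Fin d → ℝ) : ℝ :=
  ∑ i, P.K i * P.rieszDeriv i w x

/-- `U` is a classical (exact) solution of the problem. -/
structure IsExactSolution {d : ℕ} (P : RieszProblem d) (U : (Fin d → ℝ) → ℝ → ℝ) : Prop where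
  continuousOn : ContinuousOn (fun p : (Fin d → ℝ) × ℝ => U p.1 p.2)
    (closure P.Ω ×ˢ Set.Icc 0 P.T)
  differentiable_time : ∀ x ∈ P.Ω, ∀ t ∈ Set.Ioc 0 P.T,
    DifferentiableWithinAt ℝ (U x) (Set.Icc 0 P.T) t
  differentiable_space : ∀ i, ∀ x ∈ P.Ω, ∀ t ∈ Set.Ioc 0 P.T,
    ContDiffAt ℝ 2 (P.rieszPotential i (fun y => U y t) x) (x i)
  equation : ∀ x ∈ P.Ω, ∀ t ∈ Set.Ioc 0 P.T,
    P.r x t * derivWithin (U x) (Set.Icc 0 P.T) t =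
      P.spatialOp (fun y => U y t) x + P.f x t
  boundary : ∀ x ∈ frontier P.Ω, ∀ t ∈ Set.Icc 0 P.T, U x t = 0
  initial : ∀ x ∈ P.Ω, U x 0 = P.ψ x

/-- The integrand `(1 + |η|)^s |v̂(η)|` of the weighted Fourier norm. -/
def fourierWeight (s : ℝ) (v : ℝ → ℝ) (η : ℝ) : ℝ :=
  (1 + |η|) ^ s * ‖FourierTransform.fourier (fun y : ℝ => (v y : ℂ)) η‖

/-- The space `𝓛^s(ℝ)` of the `v ∈ L¹(ℝ)` with `∫ (1 + |η|)^s |v̂(η)| dη < ∞`. (The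
normalisation of the Fourier transform does not affect the space.) -/
def MemFracSobolev (s : ℝ) (v : ℝ → ℝ) : Prop :=
  MeasureTheory.Integrable v ∧ MeasureTheory.Integrable (fourierWeight s v)

/-- The restriction of the zero extension of `w` from `Ω` to `ℝ^d` to the line through `x` that is
parallel to the `i`-th axis. -/
def lineExt {d : ℕ} (P : RieszProblem d) (i : Fin d) (w : (Fin d → ℝ) → ℝ) (x : Fin d → ℝ)
    (s : ℝ) : ℝ :=
  P.Ω.indicator w (Function.update x i s)

/-- The regularity of the exact solution under which the truncation errors of the
Crank-Nicolson and of the fractional centered difference formulas have their full orders: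
three bounded time derivatives of `U`, two bounded time derivatives of the spatial operator
applied to `U`, and, on every line parallel to the `i`-th axis, membership of the zero extension of
`U(·,t)` in `𝓛^{4 + α i}(ℝ)` with a uniform bound. -/
structure IsRegular {d : ℕ} (P : RieszProblem d) (U : (Fin d → ℝ) → ℝ → ℝ) : Prop where
  time : ∃ B : ℝ, ∀ x ∈ P.Ω, ContDiffOn ℝ 3 (U x) (Set.Icc 0 P.T) ∧
    ∀ t ∈ Set.Icc 0 P.T, |iteratedDerivWithin 3 (U x) (Set.Icc 0 P.T) t| ≤ B
  time_spatialOp : ∃ B : ℝ, ∀ x ∈ P.Ω,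
    ContDiffOn ℝ 2 (fun t => P.spatialOp (fun y => U y t) x) (Set.Icc 0 P.T) ∧
    ∀ t ∈ Set.Icc 0 P.T,
      |iteratedDerivWithin 2 (fun t => P.spatialOp (fun y => U y t) x) (Set.Icc 0 P.T) t| ≤ B
  space : ∃ B : ℝ, ∀ i, ∀ x ∈ P.Ω, ∀ t ∈ Set.Icc 0 P.T,
    MemFracSobolev (4 + P.α i) (P.lineExt i (fun y => U y t) x) ∧
    ∫ η, fourierWeight (4 + P.α i) (P.lineExt i (fun y => U y t) x) η ≤ B

/-! ### The difference scheme -/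

/-- The generating function
`S^{(α)}(ω) = (1 + α/24 (2 - ω - ω⁻¹)) (2 - ω - ω⁻¹)^{α/2}` at `ω = exp(iθ)`, where
`2 - ω - ω⁻¹ = 2 - 2 cos θ`. -/
def genFun (α θ : ℝ) : ℝ :=
  (1 + α / 24 * (2 - 2 * Real.cos θ)) * (2 - 2 * Real.cos θ) ^ (α / 2)

/-- The coefficients `s_k^{(α)}`: the Fourier coefficients of the real even function
`θ ↦ S^{(α)}(exp(iθ))`. -/
def coeff (α : ℝ) (k : ℤ) : ℝ :=
  1 / (2 * Real.pi) * ∫ θ in (-Real.pi)..Real.pi, genFun α θ * Real.cos (k * θ)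

/-- The fourth-order fractional centered difference operator in the `i`-th direction, with order
`α` and step `h`: `-h^{-α} ∑_{k ∈ ℤ} s_k v_{J_i - k}`. -/
def fracDiff {d : ℕ} (α h : ℝ) (i : Fin d) (v : (Fin d → ℤ) → ℝ) (J : Fin d → ℤ) : ℝ :=
  -(1 / h ^ α) * ∑' k : ℤ, coeff α k * v (Function.update J i (J i - k))

/-- The spatial step `h i = (b i - a i) / (n i + 1)`. -/
def h {d : ℕ} (P : RieszProblem d) (n : Fin d → ℕ) (i : Fin d) : ℝ :=
  (P.b i - P.a i) / ((n i : ℝ) + 1)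

/-- The time step `Δt = T / M`. -/
def dt {d : ℕ} (P : RieszProblem d) (M : ℕ) : ℝ := P.T / (M : ℝ)

/-- The grid node `x_J`. -/
def node {d : ℕ} (P : RieszProblem d) (n : Fin d → ℕ) (J : Fin d → ℤ) : Fin d → ℝ :=
  fun i => P.a i + (J i : ℝ) * P.h n i

/-- The indices `J` of the interior nodes, `1 ≤ j_i ≤ n_i`. -/
def interiorIdx {d : ℕ} (n : Fin d → ℕ) : Finset (Fin d → ℤ) :=
  Fintype.piFinset fun i => Finset.Icc 1 (n i : ℤ)

/-- The discrete `L²`-norm of a grid function. -/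
def discreteNorm {d : ℕ} (P : RieszProblem d) (n : Fin d → ℕ) (v : (Fin d → ℤ) → ℝ) : ℝ :=
  Real.sqrt ((∏ i, P.h n i) * ∑ J ∈ interiorIdx n, v J ^ 2)

/-- `u m J`, `m = 0,…,M`, solves the CN-4FCD scheme with `n i` interior nodes in the `i`-th
direction and `M` time steps. Grid functions are extended by zero outside the interior nodes, and
the value at the level `m + 1/2` is the Crank-Nicolson average. -/
structure IsSchemeSolution {d : ℕ} (P : RieszProblem d) (n : Fin d → ℕ) (M : ℕ)
    (u : ℕ → (Fin d → ℤ) → ℝ) : Prop where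
  zero_ext : ∀ m ≤ M, ∀ J ∉ interiorIdx n, u m J = 0
  initial : ∀ J ∈ interiorIdx n, u 0 J = P.ψ (P.node n J)
  step : ∀ m < M, ∀ J ∈ interiorIdx n,
    P.r (P.node n J) (((m : ℝ) + 1 / 2) * P.dt M) * ((u (m + 1) J - u m J) / P.dt M) =
      (∑ i, P.K i * fracDiff (P.α i) (P.h n i) i (fun I => (u (m + 1) I + u m I) / 2) J) +
        P.f (P.node n J) (((m : ℝ) + 1 / 2) * P.dt M)

end

end RieszProblem

/-!
The error `e^m = u^m - U^m` satisfies the scheme with the truncation error as source, so the theorem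
is consistency plus stability.

Stability. The weight `r` is only bounded, with no regularity in time, so the error equation is
tested with the increment `e^{m+1} - e^m` rather than with the average. The weighted term is then
nonnegative and absorbs the source, and the energy `-⟨A e, e⟩` of the discrete spatial operator `A`
telescopes because `A` is symmetric (`energyForm_step_le`). The energy bounds the `L²`-norm
uniformly in the mesh by a discrete Poincaré inequality (`poincare_energyForm`). On a grid line this says that
the Toeplitz form of the coefficients is the integral of the generating function against
`|∑ w_j exp(ijθ)|²`. A sequence supported on `n` nodes has at most half of its mass in frequencies
below `π / (2n)`, and above them the generating function is at least `n^(-α)`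
(`half_sum_sq_le_sum_coeff`).

Consistency in space. On a line, write the zero extension of `U` by Fourier inversion. The
generating function has a summable Fourier series because it is `C¹` on a period, so the difference
operator is the multiplier `-h^(-α) S(2πξh)` (`tsum_coeff_mul_eq_fourier`). The Riesz derivative is
the multiplier `-|2πξ|^α` (`rieszDeriv_eq_fourier`): writing `|s|^(-β)` as a superposition of
Gaussians and applying Fubini's theorem on both sides shows that its Fourier transform is a multiple
of `|ξ|^(β-1)`, the constant coming from the duplication and reflection formulas for `Γ`. The two
multipliers differ by `O(h⁴ |ξ|^(4+α))` (`abs_genFun_sub_le`), and the weighted Fourier norm of the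
regularity assumption controls the rest.

Consistency in time uses symmetric differences about the midpoint of a step, for `U` and for the
spatial operator applied to `U`.
-/

open MeasureTheory Real FourierTransform

namespace RieszProblem

/-! ### The generating function and its Fourier series -/

theorem two_sub_two_mul_cos (θ : ℝ) : 2 - 2 * cos θ = (2 * sin (θ / 2)) ^ 2 := by
  have h := cos_two_mul (θ / 2)
  have h2 := sin_sq_add_cos_sq (θ / 2)
  rw [show 2 * (θ / 2) = θ by ring] at h
  rw [h]
  linear_combination -4 * h2

theorem genFun_eq_sin (α θ : ℝ) :
    genFun α θ = (1 + α / 6 * sin (θ / 2) ^ 2) * |2 * sin (θ / 2)| ^ α := by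
  rw [genFun, two_sub_two_mul_cos, ← sq_abs (2 * sin (θ / 2)), ← rpow_natCast,
    ← rpow_mul (abs_nonneg _)]
  congr 1
  · rw [rpow_natCast, sq_abs]; ring
  · congr 1; push_cast; ring

theorem genFun_nonneg {α : ℝ} (hα : 0 ≤ α) (θ : ℝ) : 0 ≤ genFun α θ := by
  rw [genFun_eq_sin]; positivity

theorem abs_rpow_le_genFun {α : ℝ} (hα : 0 ≤ α) (θ : ℝ) :
    |2 * sin (θ / 2)| ^ α ≤ genFun α θ := by
  rw [genFun_eq_sin]
  refine le_mul_of_one_le_left (by positivity) ?_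
  have : 0 ≤ α / 6 * sin (θ / 2) ^ 2 := by positivity
  linarith

theorem continuous_genFun {α : ℝ} (hα : 0 ≤ α) : Continuous (genFun α) := by
  have : genFun α = fun θ => (1 + α / 6 * sin (θ / 2) ^ 2) * |2 * sin (θ / 2)| ^ α :=
    funext (genFun_eq_sin α)
  rw [this]
  refine Continuous.mul (by fun_prop) (Continuous.rpow_const (by fun_prop) fun _ => Or.inr hα)

theorem genFun_neg (α θ : ℝ) : genFun α (-θ) = genFun α θ := by simp [genFun]

theorem genFun_periodic (α : ℝ) : Function.Periodic (genFun α) (2 * π) := fun θ => by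
  simp [genFun]

theorem coeff_neg (α : ℝ) (k : ℤ) : coeff α (-k) = coeff α k := by simp [coeff]

/-- `genFun α` as a continuous function on the circle `ℝ / 2πℤ`. -/
noncomputable def genFunCircle {α : ℝ} (hα : 0 ≤ α) : C(AddCircle (2 * π), ℂ) where
  toFun := ((genFun_periodic α).comp ((↑) : ℝ → ℂ)).lift
  continuous_toFun := by
    refine continuous_coinduced_dom.mpr ?_
    exact Complex.continuous_ofReal.comp (continuous_genFun hα)

theorem genFunCircle_coe {α : ℝ} (hα : 0 ≤ α) (θ : ℝ) :
    genFunCircle hα (θ : AddCircle (2 * π)) = (genFun α θ : ℂ) := rfl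

theorem fourier_two_pi [Fact (0 < 2 * π)] (n : ℤ) (θ : ℝ) :
    fourier n (θ : AddCircle (2 * π)) = Complex.exp ((n * θ : ℝ) * Complex.I) := by
  rw [fourier_coe_apply]
  congr 1
  have : (π : ℂ) ≠ 0 := by exact_mod_cast pi_ne_zero
  push_cast
  field_simp

/-- Since `genFun α` is even, its complex Fourier coefficients are the real numbers `coeff α k`. -/
theorem fourierCoeff_genFunCircle [Fact (0 < 2 * π)] {α : ℝ} (hα : 0 ≤ α) (k : ℤ) :
    fourierCoeff (genFunCircle hα) k = (coeff α k : ℂ) := by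
  have hc := continuous_genFun hα
  rw [fourierCoeff_eq_intervalIntegral _ _ (-π), show -π + 2 * π = π by ring]
  have h1 : ∀ θ : ℝ, fourier (-k) (θ : AddCircle (2 * π)) • genFunCircle hα (θ : AddCircle (2 * π))
      = ((genFun α θ * cos (k * θ) : ℝ) : ℂ) -
        ((genFun α θ * sin (k * θ) : ℝ) : ℂ) * Complex.I := by
    intro θ
    rw [fourier_two_pi, genFunCircle_coe, Complex.exp_mul_I, ← Complex.ofReal_cos,
      ← Complex.ofReal_sin]
    simp only [Int.cast_neg, neg_mul, cos_neg, sin_neg, smul_eq_mul]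
    push_cast
    ring
  simp_rw [h1]
  rw [intervalIntegral.integral_sub, intervalIntegral.integral_mul_const,
    intervalIntegral.integral_ofReal, intervalIntegral.integral_ofReal]
  · have hodd : ∫ θ in (-π)..π, genFun α θ * sin (k * θ) = 0 := by
      have := intervalIntegral.integral_comp_neg (a := -π) (b := π)
        (fun θ => genFun α θ * sin (k * θ))
      simp only [genFun_neg, mul_neg, sin_neg, intervalIntegral.integral_neg, neg_neg] at this
      linarith
    rw [hodd, coeff]
    simp
  · exact Continuous.intervalIntegrable (by fun_prop) _ _
  · exact Continuous.intervalIntegrable (by fun_prop) _ _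

/-- A `C¹` function with equal values at `0` and `2π` has absolutely summable
Fourier coefficients: those of the derivative are square summable, and dividing by the frequency
makes them summable. -/
theorem summable_fourierCoeffOn {g g' : ℝ → ℂ} (hab : (0 : ℝ) < 2 * π)
    (hg : ∀ x, HasDerivAt g (g' x) x) (hg' : Continuous g') (hper : g 0 = g (2 * π)) :
    Summable (fun k : ℤ => fourierCoeffOn hab g k) := by
  obtain ⟨C, hC⟩ := isCompact_Icc.exists_bound_of_continuousOn
    (hg'.continuousOn (s := Set.Icc 0 (2 * π)))
  have hL2 : MemLp g' 2 (volume.restrict (Set.Ioc 0 (2 * π))) := by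
    refine MemLp.mono_measure (Measure.restrict_mono Set.Ioc_subset_Icc_self le_rfl) ?_
    refine (MemLp.of_bound (p := 2) hg'.aestronglyMeasurable C ?_)
    exact (ae_restrict_iff' measurableSet_Icc).2 (Filter.Eventually.of_forall hC)
  have h1 : Summable (fun k : ℤ => ‖fourierCoeffOn hab g' k‖ ^ 2) :=
    (hasSum_sq_fourierCoeffOn hab hL2).summable
  have h2 : Summable (fun k : ℤ => 1 / (k : ℝ) ^ 2) := Real.summable_one_div_int_pow.2 one_lt_two
  refine Summable.of_norm_bounded_eventually (h1.add h2) ?_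
  rw [Filter.eventually_cofinite]
  refine (Set.finite_singleton (0 : ℤ)).subset fun k hk => ?_
  by_contra hk0
  have hk0 : k ≠ 0 := by simpa using hk0
  apply hk
  rw [fourierCoeffOn_of_hasDerivAt hab hk0 (fun x _ => hg x) (hg'.intervalIntegrable _ _), hper]
  have hkr : (0 : ℝ) < |(k : ℝ)| := by positivity
  have hn : ‖(1 / (-2 * π * Complex.I * k) * (fourier (-k) ((0 : ℝ) : AddCircle (2 * π - 0)) *
      (g (2 * π) - g (2 * π)) - ((2 * π : ℝ) - (0 : ℝ)) * fourierCoeffOn hab g' k) : ℂ)‖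
      = 1 / |(k : ℝ)| * ‖fourierCoeffOn hab g' k‖ := by
    rw [sub_self, mul_zero, zero_sub, norm_mul, norm_neg, norm_mul, norm_div, norm_mul, norm_mul,
      norm_mul]
    have : ‖((2 * π : ℝ) - (0 : ℝ) : ℂ)‖ = 2 * π := by
      rw [← Complex.ofReal_sub, Complex.norm_real, sub_zero, norm_of_nonneg hab.le]
    rw [this]
    simp only [norm_one, norm_neg, Complex.norm_ofNat, Complex.norm_real, Complex.norm_I,
      norm_of_nonneg pi_pos.le, Complex.norm_intCast]
    field_simp
  rw [hn, ← sq_abs (k : ℝ), ← one_div_pow]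
  nlinarith [sq_nonneg (‖fourierCoeffOn hab g' k‖ - 1 / |(k : ℝ)|),
    mul_nonneg (one_div_pos.2 hkr).le (norm_nonneg (fourierCoeffOn hab g' k))]

theorem summable_fourierCoeff_genFunCircle [Fact (0 < 2 * π)] {α : ℝ} (hα : 1 ≤ α) :
    Summable (fourierCoeff (genFunCircle (zero_le_one.trans hα))) := by
  have hab : (0 : ℝ) < 2 * π := Fact.out
  -- On `[0, 2π]` the sine of `θ / 2` is nonnegative, so `|2 sin (θ / 2)| ^ α` may be replaced by
  -- the real power `(2 sin (θ / 2)) ^ α`, which is `C¹` on the whole line because `α ≥ 1`.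
  let φ : ℝ → ℝ := fun θ => (1 + α / 6 * sin (θ / 2) ^ 2) * (2 * sin (θ / 2)) ^ α
  let φ' : ℝ → ℝ := fun θ => (α / 6 * (2 * sin (θ / 2) * (cos (θ / 2) * (1 / 2)))) *
      (2 * sin (θ / 2)) ^ α + (1 + α / 6 * sin (θ / 2) ^ 2) *
      (2 * (cos (θ / 2) * (1 / 2)) * α * (2 * sin (θ / 2)) ^ (α - 1))
  have hs : ∀ θ : ℝ, HasDerivAt (fun θ => sin (θ / 2)) (cos (θ / 2) * (1 / 2)) θ := fun θ =>
    ((hasDerivAt_id' θ).div_const 2).sin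
  have hφ : ∀ θ, HasDerivAt φ (φ' θ) θ := fun θ => by
    have h1 := (((hs θ).pow 2).const_mul (α / 6)).const_add 1
    have h2 := ((hs θ).const_mul 2).rpow_const (p := α) (Or.inr hα)
    exact (h1.mul h2).congr_deriv (by norm_num [φ'])
  have hφ' : Continuous φ' := by
    have h1 : Continuous fun θ : ℝ => (2 * sin (θ / 2)) ^ α :=
      Continuous.rpow_const (by fun_prop) fun _ => Or.inr (by linarith)
    have h2 : Continuous fun θ : ℝ => (2 * sin (θ / 2)) ^ (α - 1) :=
      Continuous.rpow_const (by fun_prop) fun _ => Or.inr (by linarith)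
    fun_prop
  have key := summable_fourierCoeffOn (g := fun θ => (φ θ : ℂ)) (g' := fun θ => (φ' θ : ℂ)) hab
    (fun x => (hφ x).ofReal_comp) (by fun_prop) (by
      simp only [φ, zero_div, sin_zero, mul_div_cancel_left₀ π two_ne_zero, sin_pi])
  refine key.congr fun k => ?_
  rw [fourierCoeffOn_eq_integral, fourierCoeff_eq_intervalIntegral _ _ 0, sub_zero, zero_add]
  congr 1
  refine intervalIntegral.integral_congr fun θ hθ => ?_
  rw [Set.uIcc_of_le hab.le] at hθ
  have : 0 ≤ 2 * sin (θ / 2) := by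
    have := sin_nonneg_of_nonneg_of_le_pi (x := θ / 2) (by linarith [hθ.1]) (by linarith [hθ.2])
    linarith
  simp only [genFunCircle_coe, genFun_eq_sin, abs_of_nonneg this, φ]

theorem summable_coeff {α : ℝ} (hα : 1 ≤ α) : Summable (fun k => |coeff α k|) := by
  have : Fact (0 < 2 * π) := ⟨by positivity⟩
  refine (summable_fourierCoeff_genFunCircle hα).norm.congr fun k => ?_
  rw [fourierCoeff_genFunCircle, Complex.norm_real, norm_eq_abs]

/-- The Fourier series of the generating function converges to it at every point. -/
theorem hasSum_coeff_mul_exp {α : ℝ} (hα : 1 ≤ α) (θ : ℝ) :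
    HasSum (fun k : ℤ => (coeff α k : ℂ) * Complex.exp ((k * θ : ℝ) * Complex.I))
      (genFun α θ : ℂ) := by
  have : Fact (0 < 2 * π) := ⟨by positivity⟩
  have h := has_pointwise_sum_fourier_series_of_summable
    (summable_fourierCoeff_genFunCircle hα) (θ : AddCircle (2 * π))
  simpa only [fourierCoeff_genFunCircle, fourier_two_pi, smul_eq_mul, genFunCircle_coe] using h

/-! ### Positivity of the one-dimensional difference operator -/

/-- A Toeplitz form whose coefficients are the cosine coefficients of `g` is the integral of `g`
against the squared modulus of a trigonometric polynomial. -/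
theorem integral_mul_trigPoly {g : ℝ → ℝ} (hg : Continuous g) (s : Finset ℤ) (w : ℤ → ℝ) :
    ∫ θ in (-π)..π, g θ *
        ((∑ j ∈ s, w j * cos (j * θ)) ^ 2 + (∑ j ∈ s, w j * sin (j * θ)) ^ 2) =
      ∑ j ∈ s, ∑ k ∈ s, w k * w j * ∫ θ in (-π)..π, g θ * cos ((j - k : ℤ) * θ) := by
  have h1 : ∀ θ : ℝ, g θ *
        ((∑ j ∈ s, w j * cos (j * θ)) ^ 2 + (∑ j ∈ s, w j * sin (j * θ)) ^ 2) =
      ∑ j ∈ s, ∑ k ∈ s, w k * w j * (g θ * cos ((j - k : ℤ) * θ)) := by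
    intro θ
    rw [sq, sq, Finset.sum_mul_sum, Finset.sum_mul_sum, ← Finset.sum_add_distrib, Finset.mul_sum]
    refine Finset.sum_congr rfl fun j _ => ?_
    rw [← Finset.sum_add_distrib, Finset.mul_sum]
    refine Finset.sum_congr rfl fun k _ => ?_
    push_cast
    rw [sub_mul, cos_sub]
    ring
  simp_rw [h1]
  rw [intervalIntegral.integral_finsetSum fun j _ => Continuous.intervalIntegrable
    (by fun_prop) _ _]
  refine Finset.sum_congr rfl fun j _ => ?_
  rw [intervalIntegral.integral_finsetSum fun j _ => Continuous.intervalIntegrable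
    (by fun_prop) _ _]
  simp_rw [intervalIntegral.integral_const_mul]

theorem sum_coeff_mul_eq_integral {α : ℝ} (hα : 0 ≤ α) (s : Finset ℤ) (w : ℤ → ℝ) :
    ∑ j ∈ s, ∑ k ∈ s, coeff α (j - k) * w k * w j =
      1 / (2 * π) * ∫ θ in (-π)..π, genFun α θ *
        ((∑ j ∈ s, w j * cos (j * θ)) ^ 2 + (∑ j ∈ s, w j * sin (j * θ)) ^ 2) := by
  rw [integral_mul_trigPoly (continuous_genFun hα), Finset.mul_sum]
  refine Finset.sum_congr rfl fun j _ => ?_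
  rw [Finset.mul_sum]
  refine Finset.sum_congr rfl fun k _ => ?_
  rw [coeff]
  ring

theorem sum_coeff_mul_nonneg {α : ℝ} (hα : 0 ≤ α) (s : Finset ℤ) (w : ℤ → ℝ) :
    0 ≤ ∑ j ∈ s, ∑ k ∈ s, coeff α (j - k) * w k * w j := by
  rw [sum_coeff_mul_eq_integral hα]
  refine mul_nonneg (by positivity) (intervalIntegral.integral_nonneg (by linarith [pi_pos]) ?_)
  exact fun θ _ => mul_nonneg (genFun_nonneg hα θ) (by positivity)

theorem integral_cos_int_mul (k : ℤ) :
    ∫ θ in (-π)..π, cos (k * θ) = if k = 0 then 2 * π else 0 := by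
  split_ifs with hk
  · simp [hk]; ring
  · have : (k : ℝ) ≠ 0 := by exact_mod_cast hk
    rw [intervalIntegral.integral_comp_mul_left _ this, integral_cos, mul_neg, sin_neg,
      sin_int_mul_pi]
    simp

theorem integral_trigPoly (s : Finset ℤ) (w : ℤ → ℝ) :
    ∫ θ in (-π)..π, ((∑ j ∈ s, w j * cos (j * θ)) ^ 2 + (∑ j ∈ s, w j * sin (j * θ)) ^ 2) =
      2 * π * ∑ j ∈ s, w j ^ 2 := by
  have h := integral_mul_trigPoly (g := fun _ => 1) continuous_const s w
  simp only [one_mul, integral_cos_int_mul] at h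
  rw [h, Finset.mul_sum]
  refine Finset.sum_congr rfl fun j hj => ?_
  rw [Finset.sum_eq_single j (fun k _ hk => by
    rw [if_neg (sub_ne_zero.2 hk.symm), mul_zero]) (fun h => (h hj).elim)]
  simp
  ring

theorem trigPoly_le (s : Finset ℤ) (w : ℤ → ℝ) (θ : ℝ) :
    (∑ j ∈ s, w j * cos (j * θ)) ^ 2 + (∑ j ∈ s, w j * sin (j * θ)) ^ 2 ≤
      s.card * ∑ j ∈ s, w j ^ 2 := by
  have h1 := Finset.sum_mul_sq_le_sq_mul_sq s w (fun j => cos (j * θ))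
  have h2 := Finset.sum_mul_sq_le_sq_mul_sq s w (fun j => sin (j * θ))
  calc _ ≤ (∑ j ∈ s, w j ^ 2) * ((∑ j ∈ s, cos (j * θ) ^ 2) + ∑ j ∈ s, sin (j * θ) ^ 2) := by
        rw [mul_add]; exact add_le_add h1 h2
    _ = s.card * ∑ j ∈ s, w j ^ 2 := by
        rw [← Finset.sum_add_distrib]
        simp [cos_sq_add_sin_sq, mul_comm]

theorem inv_le_abs_two_mul_sin {n : ℕ} (hn : 1 ≤ n) {θ : ℝ} (h1 : π / (2 * n) ≤ |θ|)
    (h2 : |θ| ≤ π) : 1 / (n : ℝ) ≤ |2 * sin (θ / 2)| := by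
  have hn' : (0 : ℝ) < n := by exact_mod_cast hn
  have h3 := mul_le_sin (x := |θ| / 2) (by positivity) (by linarith)
  have h4 : |2 * sin (θ / 2)| = |2 * sin (|θ| / 2)| := by
    rcases abs_choice θ with h | h <;> rw [h]
    rw [neg_div, sin_neg, mul_neg, abs_neg]
  rw [h4]
  refine le_trans ?_ (le_abs_self _)
  calc 1 / (n : ℝ) = 2 * (2 / π * (π / (2 * n) / 2)) := by field_simp
    _ ≤ 2 * (2 / π * (|θ| / 2)) := by gcongr
    _ ≤ _ := by linarith

/-- Discrete Poincaré inequality. Frequencies below `π / (2 n)` carry at most half of the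
`ℓ²`-mass of a sequence supported on `n` nodes, and above that threshold the generating function is
at least `n ^ (-α)`. -/
theorem half_sum_sq_le_sum_coeff {α : ℝ} (hα : 0 ≤ α) {n : ℕ} (hn : 1 ≤ n) (s : Finset ℤ)
    (hs : s.card = n) (w : ℤ → ℝ) :
    1 / 2 * (1 / (n : ℝ)) ^ α * ∑ j ∈ s, w j ^ 2 ≤
      ∑ j ∈ s, ∑ k ∈ s, coeff α (j - k) * w k * w j := by
  have hn' : (1 : ℝ) ≤ n := by exact_mod_cast hn
  have hc := continuous_genFun hα
  rw [sum_coeff_mul_eq_integral hα]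
  set p : ℝ → ℝ := fun θ =>
    (∑ j ∈ s, w j * cos (j * θ)) ^ 2 + (∑ j ∈ s, w j * sin (j * θ)) ^ 2 with hp
  have hpc : Continuous p := by fun_prop
  have hp0 : ∀ θ, 0 ≤ p θ := fun θ => by positivity
  set N := ∑ j ∈ s, w j ^ 2
  have htot : ∫ θ in (-π)..π, p θ = 2 * π * N := integral_trigPoly s w
  -- `p ≤ n N` pointwise, so this `δ` makes the low-frequency mass at most half of the total.
  set δ : ℝ := π / (2 * n) with hδ
  have hδ0 : 0 < δ := by positivity
  have hδπ : δ ≤ π := by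
    rw [hδ, div_le_iff₀ (by positivity)]; nlinarith [pi_pos]
  have hi : ∀ a b, IntervalIntegrable p volume a b := fun a b => hpc.intervalIntegrable a b
  have hgi : ∀ a b, IntervalIntegrable (fun θ => genFun α θ * p θ) volume a b :=
    fun a b => (hc.mul hpc).intervalIntegrable a b
  have hmid : ∫ θ in (-δ)..δ, p θ ≤ π * N := by
    calc ∫ θ in (-δ)..δ, p θ ≤ ∫ θ in (-δ)..δ, n * N :=
          intervalIntegral.integral_mono_on (by linarith) (hi _ _)
            (continuous_const.intervalIntegrable _ _) fun θ _ => hs ▸ trigPoly_le s w θ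
      _ = π * N := by
          rw [intervalIntegral.integral_const, smul_eq_mul, hδ]; field_simp; ring
  have hout : ∀ a b, a ≤ b → (∀ θ ∈ Set.Icc a b, δ ≤ |θ| ∧ |θ| ≤ π) →
      (1 / (n : ℝ)) ^ α * ∫ θ in a..b, p θ ≤ ∫ θ in a..b, genFun α θ * p θ := by
    intro a b hab h
    rw [← intervalIntegral.integral_const_mul]
    refine intervalIntegral.integral_mono_on hab ((hi a b).const_mul _) (hgi a b) fun θ hθ => ?_
    refine mul_le_mul_of_nonneg_right (le_trans ?_ (abs_rpow_le_genFun hα θ)) (hp0 θ)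
    exact rpow_le_rpow (by positivity) (inv_le_abs_two_mul_sin hn (h θ hθ).1 (h θ hθ).2) hα
  have hl := hout (-π) (-δ) (by linarith) fun θ hθ => by
    rw [abs_of_nonpos (by linarith [hθ.2])]; constructor <;> linarith [hθ.1, hθ.2]
  have hr := hout δ π (by linarith) fun θ hθ => by
    rw [abs_of_nonneg (by linarith [hθ.1])]; exact ⟨hθ.1, hθ.2⟩
  have hm : 0 ≤ ∫ θ in (-δ)..δ, genFun α θ * p θ :=
    intervalIntegral.integral_nonneg (by linarith) fun θ _ =>
      mul_nonneg (genFun_nonneg hα θ) (hp0 θ)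
  have e1 : ∫ θ in (-π)..π, p θ =
      (∫ θ in (-π)..(-δ), p θ) + (∫ θ in (-δ)..δ, p θ) + ∫ θ in δ..π, p θ := by
    rw [intervalIntegral.integral_add_adjacent_intervals (hi _ _) (hi _ _),
      intervalIntegral.integral_add_adjacent_intervals (hi _ _) (hi _ _)]
  have e2 : ∫ θ in (-π)..π, genFun α θ * p θ = (∫ θ in (-π)..(-δ), genFun α θ * p θ) +
      (∫ θ in (-δ)..δ, genFun α θ * p θ) + ∫ θ in δ..π, genFun α θ * p θ := by
    rw [intervalIntegral.integral_add_adjacent_intervals (hgi _ _) (hgi _ _),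
      intervalIntegral.integral_add_adjacent_intervals (hgi _ _) (hgi _ _)]
  have hq : 0 ≤ (1 / (n : ℝ)) ^ α := by positivity
  have key : (1 / (n : ℝ)) ^ α * (π * N) ≤ ∫ θ in (-π)..π, genFun α θ * p θ := by
    calc (1 / (n : ℝ)) ^ α * (π * N)
        ≤ (1 / (n : ℝ)) ^ α * ((∫ θ in (-π)..(-δ), p θ) + ∫ θ in δ..π, p θ) := by
          gcongr; linarith
      _ ≤ _ := by rw [e2]; linarith
  calc 1 / 2 * (1 / (n : ℝ)) ^ α * N = 1 / (2 * π) * ((1 / (n : ℝ)) ^ α * (π * N)) := by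
        field_simp
    _ ≤ _ := by gcongr

/-! ### Fourth-order accuracy of the symbol -/

theorem abs_sin_sub_cubic_le {y : ℝ} (h0 : 0 ≤ y) (h1 : y ≤ 1) :
    |sin y - (y - y ^ 3 / 6)| ≤ 5 / 96 * y ^ 5 := by
  have hd : ∀ x ∈ Set.Icc 0 y, HasDerivWithinAt (fun x => sin x - (x - x ^ 3 / 6))
      (cos x - (1 - x ^ 2 / 2)) (Set.Icc 0 y) x := fun x _ => by
    have h := (hasDerivAt_sin x).sub
      ((hasDerivAt_id' x).sub (((hasDerivAt_id' x).pow 3).div_const 6))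
    refine (h.congr_deriv ?_).hasDerivWithinAt
    norm_num
    ring
  have hb : ∀ x ∈ Set.Icc 0 y, ‖cos x - (1 - x ^ 2 / 2)‖ ≤ 5 / 96 * y ^ 4 := fun x hx => by
    have hx1 : |x| ≤ 1 := by rw [abs_of_nonneg hx.1]; linarith [hx.2]
    refine (cos_bound hx1).trans ?_
    rw [abs_of_nonneg hx.1, mul_comm]
    exact mul_le_mul_of_nonneg_left (pow_le_pow_left₀ hx.1 hx.2 4) (by norm_num)
  have := (convex_Icc 0 y).norm_image_sub_le_of_norm_hasDerivWithin_le hd hb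
    (Set.left_mem_Icc.2 h0) (Set.right_mem_Icc.2 h0)
  simp only [sin_zero, norm_eq_abs, sub_zero, abs_of_nonneg h0] at this
  calc _ ≤ _ := by simpa using this
    _ = _ := by ring

/-- With `q = sin y / y = 1 - y ^ 2 / 6 + O(y ^ 4)`, the factor `1 + α / 6 * sin y ^ 2` cancels the
second-order term of `q ^ α`. -/
theorem abs_symbol_ratio_sub_one_le {α : ℝ} (hα1 : 1 ≤ α) (hα2 : α ≤ 2) {y : ℝ} (h0 : 0 < y)
    (h1 : y ≤ 1 / 2) :
    |(1 + α / 6 * sin y ^ 2) * (sin y / y) ^ α - 1| ≤ 4 * y ^ 4 := by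
  set q := sin y / y with hq
  have hsq : sin y = y * q := by rw [hq]; field_simp
  have hqe : |q - (1 - y ^ 2 / 6)| ≤ 5 / 96 * y ^ 4 := by
    have h := abs_sin_sub_cubic_le h0.le (by linarith)
    rw [hsq, show y * q - (y - y ^ 3 / 6) = y * (q - (1 - y ^ 2 / 6)) by ring, abs_mul,
      abs_of_pos h0] at h
    refine le_of_mul_le_mul_left (h.trans (le_of_eq (by ring))) h0
  obtain ⟨hqe1, hqe2⟩ := abs_le.1 hqe
  have hy2 : y ^ 2 ≤ 1 / 4 := by nlinarith
  have hy2' : 0 < y ^ 2 := by positivity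
  have hy4 : y ^ 4 = y ^ 2 * y ^ 2 := by ring
  rw [hy4] at hqe1 hqe2 ⊢
  clear hqe
  set z := y ^ 2 with hz
  clear hy4
  have hzz : z * z ≤ 1 / 4 * z := by nlinarith
  set u := 1 - q with hu
  have hu0 : 0 ≤ u := by linarith
  have hu1 : u ≤ z / 5 := by linarith
  have hu3 : u ≤ 1 / 20 := by linarith
  have hq0 : 0 ≤ q := by linarith
  have hu2 : u * u ≤ z * z / 25 := by nlinarith
  have hpl : 1 - α * u ≤ q ^ α := by
    have := one_add_mul_self_le_rpow_one_add (s := -u) (by linarith) hα1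
    rw [show 1 + -u = q by rw [hu]; ring] at this
    linarith
  have hpu : q ^ α ≤ 1 - α * u + (α * u) ^ 2 := by
    have hle : q ≤ exp (-u) := by
      have := add_one_le_exp (-u); linarith
    have hexp : q ^ α ≤ exp (-(α * u)) := by
      calc q ^ α ≤ exp (-u) ^ α := rpow_le_rpow hq0 hle (by linarith)
        _ = exp (-(α * u)) := by rw [← exp_mul]; congr 1; ring
    have hau : |-(α * u)| ≤ 1 := by
      rw [abs_neg, abs_of_nonneg (by positivity)]; nlinarith
    have := (abs_le.1 (abs_exp_sub_one_sub_id_le hau)).2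
    nlinarith
  have hau2 : (α * u) ^ 2 ≤ 4 * (z * z / 25) := by
    calc (α * u) ^ 2 = α ^ 2 * (u * u) := by ring
      _ ≤ 4 * (z * z / 25) := by
        apply mul_le_mul _ hu2 (by positivity) (by norm_num)
        nlinarith
  -- `A` and `E` are the two factors up to errors of fourth order.
  set A := α / 6 * sin y ^ 2 with hA
  have hA' : A = α / 6 * (z * (1 - u) ^ 2) := by rw [hA, hsq, hz, hu]; ring
  set E := q ^ α with hE
  have hAe : |A - α / 6 * z| ≤ z * z / 3 := by
    rw [hA', show α / 6 * (z * (1 - u) ^ 2) - α / 6 * z = -(α / 6 * (z * (u * (2 - u)))) by ring,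
      abs_neg, abs_of_nonneg (mul_nonneg (by linarith) (mul_nonneg hy2'.le
        (mul_nonneg hu0 (by linarith))))]
    calc α / 6 * (z * (u * (2 - u))) ≤ 2 / 6 * (z * (z / 5 * 2)) := by
          have : u * (2 - u) ≤ z / 5 * 2 :=
            mul_le_mul hu1 (by linarith) (by linarith) (by linarith)
          have h0 : 0 ≤ u * (2 - u) := mul_nonneg hu0 (by linarith)
          gcongr
      _ ≤ z * z / 3 := by nlinarith
  have hEe : |E - (1 - α / 6 * z)| ≤ z * z / 2 := by
    have ha : |α * (u - z / 6)| ≤ 2 * (5 / 96 * (z * z)) := by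
      rw [abs_mul, abs_of_nonneg (by linarith : 0 ≤ α)]
      refine mul_le_mul hα2 ?_ (abs_nonneg _) (by norm_num)
      rw [abs_le]; constructor <;> linarith
    obtain ⟨ha1, ha2⟩ := abs_le.1 ha
    have e : α * (u - z / 6) = α * u - α / 6 * z := by ring
    rw [e] at ha1 ha2
    rw [abs_le]
    constructor <;> linarith [mul_pos hy2' hy2']
  have hprod : (1 + A) * E - 1 = (A - α / 6 * z) * E + (1 + α / 6 * z) * (E - (1 - α / 6 * z))
      - (α / 6 * z) ^ 2 := by ring
  have hE1 : |E| ≤ 1 := by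
    rw [abs_of_nonneg (rpow_nonneg hq0 _)]
    exact rpow_le_one hq0 (by linarith) (by linarith)
  have hB : |1 + α / 6 * z| ≤ 2 := by
    rw [abs_of_nonneg (by positivity)]; nlinarith
  have hsq2 : |(α / 6 * z) ^ 2| ≤ z * z := by
    rw [abs_of_nonneg (by positivity), show (α / 6 * z) ^ 2 = (α / 6) ^ 2 * (z * z) by ring]
    refine mul_le_of_le_one_left (by positivity) ?_
    have : α / 6 ≤ 1 := by linarith
    exact pow_le_one₀ (by linarith) this
  rw [hprod]
  calc _ ≤ |(A - α / 6 * z) * E| + |(1 + α / 6 * z) * (E - (1 - α / 6 * z))| + |(α / 6 * z) ^ 2| :=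
        (abs_sub _ _).trans (add_le_add_left (abs_add_le _ _) _)
    _ ≤ z * z / 3 * 1 + 2 * (z * z / 2) + z * z := by
        rw [abs_mul, abs_mul]; gcongr
    _ ≤ _ := by linarith [mul_pos hy2' hy2']

theorem abs_genFun_sub_le {α : ℝ} (hα1 : 1 ≤ α) (hα2 : α ≤ 2) (θ : ℝ) :
    |genFun α θ - |θ| ^ α| ≤ 3 * (|θ| ^ α * |θ| ^ 4) := by
  wlog hθ : 0 ≤ θ generalizing θ
  · have := this (-θ) (by linarith)
    rwa [genFun_neg, abs_neg] at this
  rw [genFun_eq_sin, abs_of_nonneg hθ]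
  have hα0 : 0 ≤ α := by linarith
  -- For `|θ| > 1` both symbols are bounded by a multiple of `|θ| ^ α ≤ |θ| ^ α * |θ| ^ 4`.
  rcases le_or_gt θ 1 with h1 | h1
  · rcases hθ.eq_or_lt with rfl | hpos
    · simp [show α ≠ 0 by linarith]
    have hs : 0 < sin (θ / 2) := sin_pos_of_pos_of_lt_pi (by linarith) (by linarith [pi_gt_three])
    have h := abs_symbol_ratio_sub_one_le hα1 hα2 (y := θ / 2) (by linarith) (by linarith)
    have he : |2 * sin (θ / 2)| ^ α = θ ^ α * (sin (θ / 2) / (θ / 2)) ^ α := by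
      rw [abs_of_pos (by linarith), ← mul_rpow hθ (by positivity)]
      congr 1
      field_simp
    rw [he, show (1 + α / 6 * sin (θ / 2) ^ 2) * (θ ^ α * (sin (θ / 2) / (θ / 2)) ^ α) - θ ^ α =
      θ ^ α * ((1 + α / 6 * sin (θ / 2) ^ 2) * (sin (θ / 2) / (θ / 2)) ^ α - 1) by ring, abs_mul,
      abs_of_nonneg (by positivity)]
    calc θ ^ α * |(1 + α / 6 * sin (θ / 2) ^ 2) * (sin (θ / 2) / (θ / 2)) ^ α - 1|
        ≤ θ ^ α * (4 * (θ / 2) ^ 4) := by gcongr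
      _ = 1 / 4 * (θ ^ α * θ ^ 4) := by ring
      _ ≤ _ := by gcongr; norm_num
  · have hle : |2 * sin (θ / 2)| ≤ θ := by
      rw [abs_mul, abs_two]
      have := abs_sin_le_abs (x := θ / 2)
      rw [abs_of_nonneg (by linarith : 0 ≤ θ / 2)] at this
      linarith
    have hp := rpow_le_rpow (abs_nonneg _) hle hα0
    have hA : 1 + α / 6 * sin (θ / 2) ^ 2 ≤ 2 := by
      nlinarith [sin_sq_le_one (θ / 2), sq_nonneg (sin (θ / 2))]
    have hθα : 0 ≤ θ ^ α := by positivity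
    have h4 : 1 ≤ θ ^ 4 := one_le_pow₀ h1.le
    calc _ ≤ |(1 + α / 6 * sin (θ / 2) ^ 2) * |2 * sin (θ / 2)| ^ α| + |θ ^ α| := abs_sub _ _
      _ ≤ 2 * θ ^ α + θ ^ α := by
        rw [abs_of_nonneg (by positivity), abs_of_nonneg hθα]
        gcongr
      _ = 3 * (θ ^ α * 1) := by ring
      _ ≤ _ := by gcongr

/-! ### The Riesz potential on the Fourier side -/

theorem fourierInv_real_eq (f : ℝ → ℂ) (s : ℝ) :
    𝓕⁻ f s = ∫ ξ : ℝ, Complex.exp ((2 * π * (ξ * s) : ℝ) * Complex.I) * f ξ := by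
  rw [Real.fourierInv_eq']
  simp [mul_comm s]

/-- The factor `π ^ (-β / 2) Γ(β / 2)` that makes the Fourier transform of `|s| ^ (-β)`
symmetric under `β ↦ 1 - β`. -/
noncomputable def gammaFactor (β : ℝ) : ℝ := (1 / π) ^ (β / 2) * Gamma (β / 2)

theorem gammaFactor_pos {β : ℝ} (hβ : 0 < β) : 0 < gammaFactor β :=
  mul_pos (by positivity) (Gamma_pos_of_pos (by linarith))

/-- `|s| ^ (-β)` as a superposition of Gaussians. -/
theorem integral_gaussian_rpow {β s : ℝ} (hβ : 0 < β) (hs : s ≠ 0) :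
    ∫ b in Set.Ioi (0 : ℝ), b ^ (β / 2 - 1) * exp (-(π * s ^ 2 * b)) =
      gammaFactor β * |s| ^ (-β) := by
  have hs2 : 0 < s ^ 2 := by positivity
  rw [integral_rpow_mul_exp_neg_mul_Ioi (by linarith) (by positivity), gammaFactor,
    ← one_div_mul_one_div, mul_rpow (by positivity) (by positivity), ← sq_abs s,
    one_div (|s| ^ 2), inv_rpow (by positivity), ← rpow_natCast, ← rpow_mul (abs_nonneg s),
    ← rpow_neg (abs_nonneg s)]
  rw [show -(((2 : ℕ) : ℝ) * (β / 2)) = -β by push_cast; ring]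
  ring

/-- The companion of `integral_gaussian_rpow` after inverting the width of the Gaussians. -/
theorem integral_gaussian_inv_rpow {β ξ : ℝ} (hβ : β < 1) (hξ : ξ ≠ 0) :
    ∫ b in Set.Ioi (0 : ℝ), b ^ ((β - 1) / 2 - 1) * exp (-(π * ξ ^ 2 / b)) =
      gammaFactor (1 - β) * |ξ| ^ (β - 1) := by
  rw [← integral_comp_rpow_Ioi _ (neg_ne_zero.2 one_ne_zero)]
  have h := integral_gaussian_rpow (β := 1 - β) (by linarith) hξ
  rw [show -(1 - β) = β - 1 by ring] at h
  rw [← h]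
  refine setIntegral_congr_fun measurableSet_Ioi fun x hx => ?_
  have hx : 0 < x := hx
  simp only [abs_neg, abs_one, one_mul, smul_eq_mul]
  rw [← mul_assoc, ← rpow_mul hx.le, ← rpow_add hx, rpow_neg_one, div_inv_eq_mul]
  congr 2
  ring

theorem integrableOn_gaussian_rpow {β s : ℝ} (hβ : 0 < β) (hs : s ≠ 0) :
    IntegrableOn (fun b => b ^ (β / 2 - 1) * exp (-(π * s ^ 2 * b))) (Set.Ioi (0 : ℝ)) := by
  -- A non-integrable function would have integral zero.
  by_contra h
  have h1 := integral_gaussian_rpow hβ hs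
  rw [integral_undef h] at h1
  exact (mul_pos (gammaFactor_pos hβ) (rpow_pos_of_pos (abs_pos.2 hs) _)).ne h1

theorem integrableOn_gaussian_inv_rpow {β ξ : ℝ} (hβ : β < 1) (hξ : ξ ≠ 0) :
    IntegrableOn (fun b => b ^ ((β - 1) / 2 - 1) * exp (-(π * ξ ^ 2 / b)))
      (Set.Ioi (0 : ℝ)) := by
  -- A non-integrable function would have integral zero.
  by_contra h
  have h1 := integral_gaussian_inv_rpow hβ hξ
  rw [integral_undef h] at h1
  exact (mul_pos (gammaFactor_pos (by linarith)) (rpow_pos_of_pos (abs_pos.2 hξ) _)).ne h1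

/-- Fubini's theorem for a nonnegative kernel whose total mass is integrable against `F`. -/
theorem integral_mul_setIntegral_swap {F : ℝ → ℂ} {k : ℝ → ℝ → ℝ}
    (hF : AEStronglyMeasurable F) (hk : Measurable (Function.uncurry k))
    (hk0 : ∀ x, ∀ b ∈ Set.Ioi (0 : ℝ), 0 ≤ k x b)
    (hki : ∀ᵐ x, IntegrableOn (k x) (Set.Ioi (0 : ℝ)))
    (hint : Integrable fun x => F x * ((∫ b in Set.Ioi (0 : ℝ), k x b : ℝ) : ℂ)) :
    ∫ x, F x * ((∫ b in Set.Ioi (0 : ℝ), k x b : ℝ) : ℂ) =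
      ∫ b in Set.Ioi (0 : ℝ), ∫ x, F x * (k x b : ℂ) := by
  have hm : AEStronglyMeasurable (fun p : ℝ × ℝ => F p.1 * (k p.1 p.2 : ℂ))
      (volume.prod (volume.restrict (Set.Ioi (0 : ℝ)))) := by
    refine AEStronglyMeasurable.mul hF.comp_fst ?_
    exact (Complex.measurable_ofReal.comp hk).aestronglyMeasurable
  have hprod : Integrable (Function.uncurry fun x b => F x * (k x b : ℂ))
      (volume.prod (volume.restrict (Set.Ioi (0 : ℝ)))) := by
    refine (integrable_prod_iff hm).2 ⟨?_, ?_⟩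
    · filter_upwards [hki] with x hx
      exact hx.ofReal.const_mul (F x)
    · refine hint.norm.congr (Filter.Eventually.of_forall fun x => ?_)
      simp only [norm_mul, Complex.norm_real]
      rw [integral_const_mul, norm_of_nonneg (setIntegral_nonneg measurableSet_Ioi (hk0 x))]
      congr 1
      exact setIntegral_congr_fun measurableSet_Ioi fun b hb => (norm_of_nonneg (hk0 x b hb)).symm
  rw [← integral_integral_swap hprod]
  refine integral_congr_ae (Filter.Eventually.of_forall fun x => ?_)
  simp only
  rw [integral_const_mul, integral_complex_ofReal]

/-- Parseval's identity against a Gaussian centred at `s`. -/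
theorem integral_mul_gaussian {v : ℝ → ℂ} (hv : Integrable v) (s : ℝ) {b : ℝ} (hb : 0 < b) :
    ∫ η, v η * (exp (-(π * (s - η) ^ 2 * b)) : ℝ) =
      ((b ^ (-(1 / 2) : ℝ) : ℝ) : ℂ) * ∫ ξ : ℝ,
        Complex.exp ((2 * π * (ξ * s) : ℝ) * Complex.I) * 𝓕 v ξ *
          (exp (-(π * ξ ^ 2 / b)) : ℝ) := by
  -- The modulated Gaussian `g` has the Gaussian centred at `s` as its Fourier transform.
  set g : ℝ → ℂ := fun ξ => Complex.exp (-π * (b⁻¹ : ℝ) * ξ ^ 2 + 2 * π * (s * Complex.I) * ξ)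
    with hg
  have hbi : 0 < ((b⁻¹ : ℝ) : ℂ).re := by rw [Complex.ofReal_re]; positivity
  have hgi : Integrable g := by
    have h : (-(π : ℂ) * (b⁻¹ : ℝ)).re < 0 := by
      rw [neg_mul, Complex.neg_re, Complex.re_ofReal_mul]
      have := mul_pos pi_pos hbi
      linarith
    have := integrable_cexp_quadratic' h (2 * π * (s * Complex.I)) 0
    simpa only [add_zero] using this
  have hFg : ∀ η : ℝ, 𝓕 g η = ((b ^ (1 / 2 : ℝ) : ℝ) : ℂ) * (exp (-(π * (s - η) ^ 2 * b)) : ℝ) := by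
    intro η
    rw [hg, fourier_gaussian_pi' hbi]
    simp only
    rw [show ((1 : ℂ) / 2) = ((1 / 2 : ℝ) : ℂ) by push_cast; ring,
      ← Complex.ofReal_cpow (by positivity),
      inv_rpow hb.le]
    have h2 : (-(π : ℂ) / ((b⁻¹ : ℝ) : ℂ) * (η + Complex.I * (s * Complex.I)) ^ 2) =
        ((-(π * (s - η) ^ 2 * b) : ℝ) : ℂ) := by
      rw [show (Complex.I * (s * Complex.I) : ℂ) = -s by
        rw [mul_comm (s : ℂ), ← mul_assoc, Complex.I_mul_I]; ring]
      push_cast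
      rw [div_inv_eq_mul]
      ring
    rw [h2, Complex.ofReal_exp]
    push_cast
    rw [one_div, inv_inv]
  have hflip : ∫ ξ, 𝓕 v ξ * g ξ = ∫ η, v η * 𝓕 g η := by
    simpa using! (VectorFourier.integral_fourierIntegral_smul_eq_flip (L := innerₗ ℝ)
      Real.continuous_fourierChar continuous_inner hv hgi)
  have hrhs : ∫ ξ : ℝ, Complex.exp ((2 * π * (ξ * s) : ℝ) * Complex.I) * 𝓕 v ξ *
          (exp (-(π * ξ ^ 2 / b)) : ℝ) = ∫ ξ, 𝓕 v ξ * g ξ := by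
    refine integral_congr_ae (Filter.Eventually.of_forall fun ξ => ?_)
    simp only [hg]
    rw [mul_comm (Complex.exp _) (𝓕 v ξ), mul_assoc, Complex.ofReal_exp, ← Complex.exp_add]
    congr 2
    push_cast
    ring
  rw [hrhs, hflip]
  simp_rw [hFg]
  rw [← integral_const_mul]
  refine integral_congr_ae (Filter.Eventually.of_forall fun η => ?_)
  simp only
  rw [mul_left_comm, ← mul_assoc (((b ^ (-(1 / 2) : ℝ) : ℝ)) : ℂ), ← Complex.ofReal_mul,
    ← rpow_add hb]
  simp

/-- Up to the gamma factors, `|s| ^ (-β)` has the Fourier transform `|ξ| ^ (β - 1)`. Both sides are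
superpositions of the identity `integral_mul_gaussian` over the width of the Gaussian. -/
theorem integral_mul_abs_rpow_eq_fourier {β : ℝ} (h0 : 0 < β) (h1 : β < 1) {v : ℝ → ℂ}
    (hv : Integrable v) (s : ℝ) (hvs : Integrable fun η => v η * ((|s - η| ^ (-β) : ℝ) : ℂ))
    (hV : Integrable fun ξ : ℝ => ((|ξ| ^ (β - 1) : ℝ) : ℂ) * 𝓕 v ξ) :
    (gammaFactor β : ℂ) * ∫ η, v η * ((|s - η| ^ (-β) : ℝ) : ℂ) =
      gammaFactor (1 - β) * 𝓕⁻ (fun ξ : ℝ => ((|ξ| ^ (β - 1) : ℝ) : ℂ) * 𝓕 v ξ) s := by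
  set k₁ : ℝ → ℝ → ℝ := fun η b => b ^ (β / 2 - 1) * exp (-(π * (s - η) ^ 2 * b)) with hk₁
  set k₂ : ℝ → ℝ → ℝ := fun ξ b => b ^ ((β - 1) / 2 - 1) * exp (-(π * ξ ^ 2 / b)) with hk₂
  set F : ℝ → ℂ := fun ξ => Complex.exp ((2 * π * (ξ * s) : ℝ) * Complex.I) * 𝓕 v ξ with hF
  have hVc : Continuous (𝓕 v) := VectorFourier.fourierIntegral_continuous
    Real.continuous_fourierChar continuous_inner hv
  have hFc : Continuous F := by fun_prop
  have hm₁ : Measurable (Function.uncurry k₁) := by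
    simp only [hk₁, Function.uncurry_def]
    fun_prop
  have hm₂ : Measurable (Function.uncurry k₂) := by
    simp only [hk₂, Function.uncurry_def]
    fun_prop
  have hne₁ : ∀ᵐ η : ℝ, s - η ≠ 0 := by
    filter_upwards [Measure.ae_ne volume s] with η hη
    exact sub_ne_zero.2 hη.symm
  have hne₂ : ∀ᵐ ξ : ℝ, ξ ≠ 0 := Measure.ae_ne volume 0
  have e₁ : ∀ᵐ η : ℝ, v η * ((∫ b in Set.Ioi (0 : ℝ), k₁ η b : ℝ) : ℂ) =
      gammaFactor β * (v η * ((|s - η| ^ (-β) : ℝ) : ℂ)) := by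
    filter_upwards [hne₁] with η hη
    rw [hk₁, integral_gaussian_rpow h0 hη]
    push_cast
    ring
  have e₂ : ∀ᵐ ξ : ℝ, F ξ * ((∫ b in Set.Ioi (0 : ℝ), k₂ ξ b : ℝ) : ℂ) =
      gammaFactor (1 - β) * (Complex.exp ((2 * π * (ξ * s) : ℝ) * Complex.I) *
        (((|ξ| ^ (β - 1) : ℝ) : ℂ) * 𝓕 v ξ)) := by
    filter_upwards [hne₂] with ξ hξ
    rw [hk₂, integral_gaussian_inv_rpow h1 hξ]
    simp only [hF]
    push_cast
    ring
  have hexp : Integrable fun ξ : ℝ => Complex.exp ((2 * π * (ξ * s) : ℝ) * Complex.I) *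
        (((|ξ| ^ (β - 1) : ℝ) : ℂ) * 𝓕 v ξ) :=
    hV.bdd_mul (c := 1) (Continuous.aestronglyMeasurable (by fun_prop))
      (Filter.Eventually.of_forall fun ξ => (Complex.norm_exp_ofReal_mul_I _).le)
  have s₁ := integral_mul_setIntegral_swap (F := v) (k := k₁) hv.aestronglyMeasurable hm₁
    (fun x b hb => mul_nonneg (rpow_nonneg (le_of_lt hb) _) (exp_pos _).le)
    (hne₁.mono fun η hη => integrableOn_gaussian_rpow h0 hη)
    ((hvs.const_mul _).congr (e₁.mono fun _ h => h.symm))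
  have s₂ := integral_mul_setIntegral_swap (F := F) (k := k₂) hFc.aestronglyMeasurable hm₂
    (fun x b hb => mul_nonneg (rpow_nonneg (le_of_lt hb) _) (exp_pos _).le)
    (hne₂.mono fun η hη => integrableOn_gaussian_inv_rpow h1 hη)
    ((hexp.const_mul _).congr (e₂.mono fun _ h => h.symm))
  rw [integral_congr_ae e₁, integral_const_mul] at s₁
  rw [integral_congr_ae e₂, integral_const_mul] at s₂
  rw [fourierInv_real_eq, s₁, s₂]
  refine setIntegral_congr_fun measurableSet_Ioi fun b hb => ?_
  have hb : 0 < b := hb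
  have g := integral_mul_gaussian hv s hb
  calc ∫ η, v η * (k₁ η b : ℂ)
      = ((b ^ (β / 2 - 1) : ℝ) : ℂ) * ∫ η, v η * (exp (-(π * (s - η) ^ 2 * b)) : ℝ) := by
        rw [← integral_const_mul]
        congr 1 with η
        simp only [hk₁]
        push_cast
        ring
    _ = ∫ ξ, F ξ * (k₂ ξ b : ℂ) := by
        rw [g, ← mul_assoc, ← Complex.ofReal_mul, ← rpow_add hb, ← integral_const_mul]
        congr 1 with ξ
        simp only [hk₂, hF]
        rw [show β / 2 - 1 + -(1 / 2) = (β - 1) / 2 - 1 by ring]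
        push_cast
        ring

/-- The ratio of gamma factors, from the duplication and reflection formulas. -/
theorem gammaFactor_ratio {α : ℝ} (h1 : 1 < α) (h2 : α < 2) :
    1 / (2 * cos (α * π / 2) * Gamma (2 - α)) * (gammaFactor (2 - α) / gammaFactor (α - 1)) *
      (4 * π ^ 2) = -(2 * π) ^ α := by
  have hcos : cos (α * π / 2) < 0 := by
    refine cos_neg_of_pi_div_two_lt_of_lt ?_ ?_ <;> nlinarith [pi_pos]
  have hG : 0 < Gamma (2 - α) := Gamma_pos_of_pos (by linarith)
  have hG1 : 0 < Gamma ((α - 1) / 2) := Gamma_pos_of_pos (by linarith)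
  have hG2 : 0 < Gamma ((2 - α) / 2) := Gamma_pos_of_pos (by linarith)
  have hG3 : 0 < Gamma ((3 - α) / 2) := Gamma_pos_of_pos (by linarith)
  have dup := Gamma_mul_Gamma_add_half ((2 - α) / 2)
  rw [show (2 - α) / 2 + 1 / 2 = (3 - α) / 2 by ring, show 2 * ((2 - α) / 2) = 2 - α by ring,
    show 1 - (2 - α) = α - 1 by ring] at dup
  have hrefl := Gamma_mul_Gamma_one_sub ((α - 1) / 2)
  rw [show 1 - (α - 1) / 2 = (3 - α) / 2 by ring,
    show π * ((α - 1) / 2) = -(π / 2 - α * π / 2) by ring, sin_neg, sin_pi_div_two_sub] at hrefl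
  have hratio : Gamma ((2 - α) / 2) * π =
      -(Gamma ((α - 1) / 2) * Gamma (2 - α) * 2 ^ (α - 1) * √π * cos (α * π / 2)) := by
    have hc : -cos (α * π / 2) ≠ 0 := (neg_pos.2 hcos).ne'
    rw [eq_div_iff hc] at hrefl
    have := hG3.ne'
    apply mul_left_cancel₀ this
    linear_combination π * dup - Gamma (2 - α) * 2 ^ (α - 1) * √π * hrefl
  have hpow : (1 / π) ^ ((2 - α) / 2) * √π * π = (1 / π) ^ ((α - 1) / 2) * π ^ α := by
    have e : ∀ x : ℝ, (1 / π) ^ x = π ^ (-x) := fun x => by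
      rw [one_div, inv_rpow pi_pos.le, rpow_neg pi_pos.le]
    rw [e, e, sqrt_eq_rpow, ← rpow_add pi_pos, ← rpow_add_one pi_pos.ne', ← rpow_add pi_pos]
    congr 1
    ring
  have h2α : (2 : ℝ) ^ α = 2 ^ (α - 1) * 2 := by
    rw [← rpow_add_one two_ne_zero]; congr 1; ring
  have hp : 0 < (1 / π) ^ ((α - 1) / 2) := by positivity
  rw [mul_rpow (by norm_num) pi_pos.le, h2α, gammaFactor, gammaFactor]
  generalize (1 / π) ^ ((2 - α) / 2) = p₂ at *
  generalize (1 / π) ^ ((α - 1) / 2) = p₁ at *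
  generalize Gamma ((2 - α) / 2) = G₂ at *
  generalize Gamma ((α - 1) / 2) = G₁ at *
  generalize Gamma (2 - α) = G at *
  generalize cos (α * π / 2) = c at *
  have hc : c ≠ 0 := hcos.ne
  rw [div_mul_div_comm, div_mul_eq_mul_div, div_eq_iff (by positivity)]
  linear_combination 4 * p₂ * π * hratio - 4 * G₁ * G * 2 ^ (α - 1) * c * hpow

/-- The Fourier transform of an integrable function whose transform has a finite weighted norm is
integrable against every power between `-1` and the order of the weight. -/
theorem integrable_abs_rpow_mul_fourier {v : ℝ → ℂ} (hv : Integrable v) {σ p : ℝ} (hσ : 0 ≤ σ)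
    (hw : Integrable fun ξ : ℝ => (1 + |ξ|) ^ σ * ‖𝓕 v ξ‖) (hp : -1 < p) (hpσ : p ≤ σ) :
    Integrable fun ξ : ℝ => ((|ξ| ^ p : ℝ) : ℂ) * 𝓕 v ξ := by
  have hVc : Continuous (𝓕 v) := VectorFourier.fourierIntegral_continuous
    Real.continuous_fourierChar continuous_inner hv
  have hbd : ∀ ξ, ‖𝓕 v ξ‖ ≤ ∫ x, ‖v x‖ := fun ξ =>
    VectorFourier.norm_fourierIntegral_le_integral_norm _ _ _ _ _
  have hball : IntegrableOn (fun ξ : ℝ => |ξ| ^ p) (Metric.ball 0 1) :=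
    integrableOn_ball_of_norm_le_rpow (C := 1) (α := -p) (by simp)
      (by simp only [Module.finrank_self, Nat.cast_one]; linarith)
      (Filter.Eventually.of_forall fun ξ => by
        rw [neg_neg, one_mul, norm_of_nonneg (by positivity), norm_eq_abs])
      (Measurable.aestronglyMeasurable (by fun_prop))
  have hind := (hball.integrable_indicator Metric.isOpen_ball.measurableSet).mul_const
    (∫ x, ‖v x‖)
  refine (hind.add hw).mono' ?_ (Filter.Eventually.of_forall fun ξ => ?_)
  · refine AEStronglyMeasurable.mul (Measurable.aestronglyMeasurable ?_) hVc.aestronglyMeasurable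
    fun_prop
  · rw [norm_mul, Complex.norm_real, norm_of_nonneg (by positivity)]
    simp only [Pi.add_apply]
    by_cases h : |ξ| < 1
    · rw [Set.indicator_of_mem (by simpa using h)]
      have : |ξ| ^ p * ‖𝓕 v ξ‖ ≤ |ξ| ^ p * ∫ x, ‖v x‖ := by gcongr; exact hbd ξ
      have : 0 ≤ (1 + |ξ|) ^ σ * ‖𝓕 v ξ‖ := by positivity
      linarith
    · rw [Set.indicator_of_notMem (by simpa using h), zero_mul, zero_add]
      push Not at h
      gcongr
      calc |ξ| ^ p ≤ |ξ| ^ σ := rpow_le_rpow_of_exponent_le h hpσ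
        _ ≤ (1 + |ξ|) ^ σ := rpow_le_rpow (abs_nonneg _) (by linarith) hσ

theorem hasDerivAt_fourierInv {f : ℝ → ℂ} (hf : Integrable f)
    (hf' : Integrable fun x : ℝ => (x : ℂ) * f x) (s : ℝ) :
    HasDerivAt (𝓕⁻ f) (𝓕⁻ (fun x : ℝ => 2 * π * Complex.I * x * f x) s) s := by
  rw [Real.fourierInv_eq_fourier_comp_neg, Real.fourierInv_eq_fourier_comp_neg]
  have h := Real.hasDerivAt_fourier (f := fun x => f (-x)) hf.comp_neg
    (by simpa using hf'.comp_neg.neg) s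
  refine h.congr_deriv (congrFun (congrArg _ (funext fun x => ?_)) s)
  push_cast
  rw [smul_eq_mul]
  ring

/-- The second derivative of the Riesz potential is a Fourier multiplier applied to the function. -/
theorem deriv_deriv_integral_mul_abs_rpow {β : ℝ} (h0 : 0 < β) (h1 : β < 1) {v : ℝ → ℝ}
    (hvc : Continuous v) (hvs : HasCompactSupport v) {σ : ℝ} (hσ : β + 1 ≤ σ)
    (hw : Integrable fun ξ : ℝ => (1 + |ξ|) ^ σ * ‖𝓕 (fun y => (v y : ℂ)) ξ‖) (s : ℝ) :
    deriv (deriv fun s => ∫ η, v η * |s - η| ^ (-β)) s =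
      -(gammaFactor (1 - β) / gammaFactor β * (4 * π ^ 2)) *
        (𝓕⁻ (fun ξ : ℝ => ((|ξ| ^ (β + 1) : ℝ) : ℂ) * 𝓕 (fun y => (v y : ℂ)) ξ) s).re := by
  have hv : Integrable fun y => (v y : ℂ) := (hvc.integrable_of_hasCompactSupport hvs).ofReal
  set V := 𝓕 (fun y => (v y : ℂ)) with hV
  have hVi : ∀ p : ℝ, -1 < p → p ≤ σ → Integrable fun ξ : ℝ => ((|ξ| ^ p : ℝ) : ℂ) * V ξ :=
    fun p => integrable_abs_rpow_mul_fourier hv (by linarith) hw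
  have hVc : Continuous V := VectorFourier.fourierIntegral_continuous
    Real.continuous_fourierChar continuous_inner hv
  have hint : ∀ s : ℝ, Integrable fun η => v η * |s - η| ^ (-β) := by
    intro s
    have hloc : LocallyIntegrable (fun η : ℝ => |η| ^ (-β)) :=
      locallyIntegrable_of_norm_le_rpow (C := 1) (α := β) (by simp) (by simpa using h1)
        (Filter.Eventually.of_forall fun ξ => by
          rw [one_mul, norm_of_nonneg (by positivity), norm_eq_abs])
        (Measurable.aestronglyMeasurable (by fun_prop))
    have h := hloc.integrable_smul_left_of_hasCompactSupport (g := fun η => v (s - η))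
      (by fun_prop) (hvs.comp_homeomorph (Homeomorph.subLeft s))
    have := h.comp_sub_left s
    simpa using this
  set c : ℝ := gammaFactor (1 - β) / gammaFactor β with hc
  -- The potential is `c • 𝓕⁻ W`; it is differentiated twice under the integral sign.
  set W : ℝ → ℂ := fun ξ => ((|ξ| ^ (β - 1) : ℝ) : ℂ) * V ξ with hW
  have hW0 : Integrable W := hVi _ (by linarith) (by linarith)
  have hWm : AEStronglyMeasurable W := hW0.aestronglyMeasurable
  have hnorm : ∀ ξ : ℝ, |ξ| * |ξ| ^ (β - 1) = |ξ| ^ β := fun ξ => by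
    rcases eq_or_ne ξ 0 with rfl | h
    · simp [h0.ne']
    · rw [mul_comm, ← rpow_add_one (abs_pos.2 h).ne', sub_add_cancel]
  have hnorm2 : ∀ ξ : ℝ, ξ ^ 2 * |ξ| ^ (β - 1) = |ξ| ^ (β + 1) := fun ξ => by
    rcases eq_or_ne ξ 0 with rfl | h
    · simp [show β + 1 ≠ 0 by linarith]
    · rw [rpow_add_one (abs_pos.2 h).ne', ← hnorm ξ, ← sq_abs]; ring
  have hW1 : Integrable fun ξ : ℝ => (ξ : ℂ) * W ξ := by
    refine (hVi β (by linarith) (by linarith)).mono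
      (Continuous.aestronglyMeasurable (by fun_prop) |>.mul hWm)
      (Filter.Eventually.of_forall fun ξ => le_of_eq ?_)
    simp only [hW, norm_mul, Complex.norm_real, norm_eq_abs]
    rw [← mul_assoc, abs_of_nonneg (by positivity : 0 ≤ |ξ| ^ (β - 1)), hnorm,
      abs_of_nonneg (by positivity : 0 ≤ |ξ| ^ β)]
  have hW2eq : ∀ ξ : ℝ, (ξ : ℂ) * ((ξ : ℂ) * W ξ) = ((|ξ| ^ (β + 1) : ℝ) : ℂ) * V ξ := fun ξ => by
    rw [← hnorm2, hW]; push_cast; ring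
  have hW2 : Integrable fun ξ : ℝ => (ξ : ℂ) * ((ξ : ℂ) * W ξ) := by
    simp_rw [hW2eq]
    exact hVi _ (by linarith) hσ
  have hpot : ∀ s : ℝ, ∫ η, v η * |s - η| ^ (-β) = c * (𝓕⁻ W s).re := by
    intro s
    have h := integral_mul_abs_rpow_eq_fourier h0 h1 hv s
      ((hint s).ofReal.congr (Filter.Eventually.of_forall fun η => by push_cast; rfl)) hW0
    have hg := (gammaFactor_pos h0).ne'
    have h2 : ∫ η, (v η : ℂ) * ((|s - η| ^ (-β) : ℝ) : ℂ) =
        ((∫ η, v η * |s - η| ^ (-β) : ℝ) : ℂ) := by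
      rw [← integral_complex_ofReal]
      congr 1 with η
      push_cast
      rfl
    rw [h2, ← Complex.ofReal_mul] at h
    have := congrArg Complex.re h
    rw [Complex.ofReal_re, Complex.re_ofReal_mul] at this
    rw [hc, div_mul_eq_mul_div, eq_div_iff hg, ← this, mul_comm]
  have hre : ∀ {g : ℝ → ℂ} {g' : ℂ} {s : ℝ}, HasDerivAt g g' s →
      HasDerivAt (fun s => c * (g s).re) (c * g'.re) s := fun h =>
    (Complex.reCLM.hasFDerivAt.comp_hasDerivAt _ h).const_mul c
  have hd1 : ∀ s, HasDerivAt (𝓕⁻ W) (𝓕⁻ (fun x : ℝ => 2 * π * Complex.I * x * W x) s) s :=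
    hasDerivAt_fourierInv hW0 hW1
  have hW1' : Integrable fun x : ℝ => 2 * π * Complex.I * x * W x :=
    (hW1.const_mul (2 * π * Complex.I)).congr (Filter.Eventually.of_forall fun x => by
      simp only; ring)
  have hd2 := hasDerivAt_fourierInv hW1' ((hW2.const_mul (2 * π * Complex.I)).congr
    (Filter.Eventually.of_forall fun x => by simp only; ring))
  have hderiv : deriv (fun s => ∫ η, v η * |s - η| ^ (-β)) =
      fun s => c * (𝓕⁻ (fun x : ℝ => 2 * π * Complex.I * x * W x) s).re := by
    ext s
    simp_rw [hpot]
    exact (hre (hd1 s)).deriv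
  rw [hderiv, (hre (hd2 s)).deriv]
  have hfin : 𝓕⁻ (fun x : ℝ => 2 * π * Complex.I * x * (2 * π * Complex.I * x * W x)) s =
      ((-(4 * π ^ 2) : ℝ) : ℂ) * 𝓕⁻ (fun ξ : ℝ => ((|ξ| ^ (β + 1) : ℝ) : ℂ) * V ξ) s := by
    rw [fourierInv_real_eq, fourierInv_real_eq, ← integral_const_mul]
    congr 1 with ξ
    rw [← hW2eq]
    push_cast
    linear_combination (4 * π ^ 2 * (Complex.exp ((2 * π * (ξ * s)) * Complex.I)) * ξ ^ 2 * W ξ) *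
      Complex.I_sq
  rw [hfin, Complex.re_ofReal_mul]
  ring

/-! ### Truncation error in space -/

theorem integrable_fourier_of_weight {v : ℝ → ℂ} (hv : Integrable v) {σ : ℝ} (hσ : 0 ≤ σ)
    (hw : Integrable fun ξ : ℝ => (1 + |ξ|) ^ σ * ‖𝓕 v ξ‖) : Integrable (𝓕 v) := by
  simpa using integrable_abs_rpow_mul_fourier hv hσ hw (p := 0) (by norm_num) hσ

/-- The difference operator is a Fourier multiplier whose symbol is the generating function. -/
theorem tsum_coeff_mul_eq_fourier {α : ℝ} (hα : 1 ≤ α) {v : ℝ → ℝ} (hvc : Continuous v)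
    (hv : Integrable v) (hV : Integrable (𝓕 fun y => (v y : ℂ))) (h x : ℝ) :
    ∑' k : ℤ, coeff α k * v (x - k * h) =
      (𝓕⁻ (fun ξ : ℝ => (genFun α (2 * π * ξ * h) : ℂ) * 𝓕 (fun y => (v y : ℂ)) ξ) x).re := by
  set V := 𝓕 fun y => (v y : ℂ) with hVdef
  have hVc : Continuous V := VectorFourier.fourierIntegral_continuous
    Real.continuous_fourierChar continuous_inner hv.ofReal
  have hinv : ∀ y : ℝ, (v y : ℂ) =
      ∫ ξ : ℝ, Complex.exp ((2 * π * (ξ * y) : ℝ) * Complex.I) * V ξ := fun y => by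
    have := hv.ofReal.fourierInv_fourier_eq hV (v := y)
      (Complex.continuous_ofReal.comp hvc).continuousAt
    rw [← fourierInv_real_eq]
    exact this.symm
  set F : ℤ → ℝ → ℂ := fun k ξ =>
    (coeff α k : ℂ) * (Complex.exp ((2 * π * (ξ * (x - k * h)) : ℝ) * Complex.I) * V ξ) with hF
  have hFi : ∀ k, Integrable (F k) := fun k =>
    (hV.bdd_mul (c := 1) (Continuous.aestronglyMeasurable (by fun_prop))
      (Filter.Eventually.of_forall fun ξ => (Complex.norm_exp_ofReal_mul_I _).le)).const_mul _
  have hFn : ∀ k ξ, ‖F k ξ‖ = |coeff α k| * ‖V ξ‖ := fun k ξ => by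
    simp only [hF, norm_mul, Complex.norm_real, Complex.norm_exp_ofReal_mul_I, one_mul, norm_eq_abs]
  have hsum : Summable fun k => ∫ ξ, ‖F k ξ‖ := by
    simp_rw [hFn, integral_const_mul]
    exact (summable_coeff hα).mul_right _
  have key := hasSum_integral_of_summable_integral_norm hFi hsum
  have hleft : ∀ k, ∫ ξ, F k ξ = ((coeff α k * v (x - k * h) : ℝ) : ℂ) := fun k => by
    simp only [hF]
    rw [integral_const_mul, ← hinv]
    push_cast
    rfl
  have hright : ∀ ξ, ∑' k, F k ξ = Complex.exp ((2 * π * (ξ * x) : ℝ) * Complex.I) *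
      ((genFun α (2 * π * ξ * h) : ℂ) * V ξ) := fun ξ => by
    have := (hasSum_coeff_mul_exp hα (-(2 * π * ξ * h))).mul_left
      (Complex.exp ((2 * π * (ξ * x) : ℝ) * Complex.I) * V ξ)
    rw [genFun_neg] at this
    rw [show Complex.exp ((2 * π * (ξ * x) : ℝ) * Complex.I) *
      ((genFun α (2 * π * ξ * h) : ℂ) * V ξ) = Complex.exp ((2 * π * (ξ * x) : ℝ) * Complex.I) *
      V ξ * (genFun α (2 * π * ξ * h) : ℂ) by ring, ← this.tsum_eq]
    congr 1 with k
    simp only [hF]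
    rw [show ((2 * π * (ξ * (x - k * h)) : ℝ) : ℂ) * Complex.I =
      (2 * π * (ξ * x) : ℝ) * Complex.I + ((k * -(2 * π * ξ * h) : ℝ) : ℂ) * Complex.I by
        push_cast; ring, Complex.exp_add]
    ring
  simp_rw [hleft, hright] at key
  rw [fourierInv_real_eq, ← key.tsum_eq, ← Complex.ofReal_tsum, Complex.ofReal_re]

/-- The fourth-order estimate for the difference operator on a line: its symbol differs from that of
the Riesz derivative by `O(h ^ 4 |ξ| ^ (4 + α))`. -/
theorem abs_tsum_coeff_sub_le {α : ℝ} (hα1 : 1 ≤ α) (hα2 : α ≤ 2) {v : ℝ → ℝ}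
    (hvc : Continuous v) (hv : Integrable v)
    (hw : Integrable fun ξ : ℝ => (1 + |ξ|) ^ (4 + α) * ‖𝓕 (fun y => (v y : ℂ)) ξ‖)
    {h : ℝ} (hh : 0 < h) (x : ℝ) :
    |-(1 / h ^ α) * ∑' k : ℤ, coeff α k * v (x - k * h) -
        -((2 * π) ^ α * (𝓕⁻ (fun ξ : ℝ => ((|ξ| ^ α : ℝ) : ℂ) * 𝓕 (fun y => (v y : ℂ)) ξ) x).re)| ≤
      3 * (2 * π) ^ (4 + α) * h ^ 4 *
        ∫ ξ : ℝ, (1 + |ξ|) ^ (4 + α) * ‖𝓕 (fun y => (v y : ℂ)) ξ‖ := by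
  have hV := integrable_fourier_of_weight hv.ofReal (by linarith) hw
  rw [tsum_coeff_mul_eq_fourier hα1 hvc hv hV]
  have hVa := integrable_abs_rpow_mul_fourier hv.ofReal (by linarith) hw (p := α) (by linarith)
    (by linarith)
  set V := 𝓕 fun y => (v y : ℂ) with hVdef
  have hVc : Continuous V := VectorFourier.fourierIntegral_continuous
    Real.continuous_fourierChar continuous_inner hv.ofReal
  have hgc := continuous_genFun (show 0 ≤ α by linarith)
  have hbd : ∀ ξ : ℝ, ‖Complex.exp ((2 * π * (ξ * x) : ℝ) * Complex.I)‖ ≤ 1 := fun ξ =>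
    (Complex.norm_exp_ofReal_mul_I _).le
  have hgb : ∀ θ, ‖(genFun α θ : ℂ)‖ ≤ 2 * 2 ^ α := fun θ => by
    rw [Complex.norm_real, norm_of_nonneg (genFun_nonneg (by linarith) θ), genFun_eq_sin]
    have h1 : |2 * sin (θ / 2)| ≤ 2 := by
      rw [abs_mul, abs_two]; linarith [abs_sin_le_one (θ / 2)]
    have h2 : α / 6 * sin (θ / 2) ^ 2 ≤ 1 :=
      mul_le_one₀ (by linarith) (sq_nonneg _) (sin_sq_le_one _)
    have := rpow_le_rpow (abs_nonneg _) h1 (show 0 ≤ α by linarith)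
    gcongr
    linarith
  have i₁ : Integrable fun ξ : ℝ => Complex.exp ((2 * π * (ξ * x) : ℝ) * Complex.I) *
      ((genFun α (2 * π * ξ * h) : ℂ) * V ξ) :=
    (hV.bdd_mul (c := 2 * 2 ^ α) (Continuous.aestronglyMeasurable (by fun_prop))
      (Filter.Eventually.of_forall fun ξ => hgb _)).bdd_mul
      (c := 1) (Continuous.aestronglyMeasurable (by fun_prop)) (Filter.Eventually.of_forall hbd)
  have i₂ : Integrable fun ξ : ℝ => Complex.exp ((2 * π * (ξ * x) : ℝ) * Complex.I) *
      (((|ξ| ^ α : ℝ) : ℂ) * V ξ) :=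
    hVa.bdd_mul (c := 1) (Continuous.aestronglyMeasurable (by fun_prop))
      (Filter.Eventually.of_forall hbd)
  have hdiff : -(1 / h ^ α) * (𝓕⁻ (fun ξ : ℝ => (genFun α (2 * π * ξ * h) : ℂ) * V ξ) x).re -
        -((2 * π) ^ α * (𝓕⁻ (fun ξ : ℝ => ((|ξ| ^ α : ℝ) : ℂ) * V ξ) x).re) =
      (∫ ξ : ℝ, (((2 * π) ^ α * |ξ| ^ α - 1 / h ^ α * genFun α (2 * π * ξ * h) : ℝ) : ℂ) *
        (Complex.exp ((2 * π * (ξ * x) : ℝ) * Complex.I) * V ξ)).re := by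
    rw [fourierInv_real_eq, fourierInv_real_eq, ← Complex.re_ofReal_mul, ← Complex.re_ofReal_mul,
      sub_neg_eq_add, ← Complex.add_re, ← integral_const_mul, ← integral_const_mul,
      ← integral_add (i₁.const_mul _) (i₂.const_mul _)]
    congr 2 with ξ
    push_cast
    ring
  rw [hdiff]
  refine (Complex.abs_re_le_norm _).trans ?_
  rw [← integral_const_mul]
  refine norm_integral_le_of_norm_le (hw.const_mul _) (Filter.Eventually.of_forall fun ξ => ?_)
  rw [norm_mul, norm_mul, Complex.norm_exp_ofReal_mul_I, one_mul, Complex.norm_real, norm_eq_abs,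
    ← mul_assoc]
  refine mul_le_mul_of_nonneg_right ?_ (norm_nonneg _)
  have hha : 0 < h ^ α := by positivity
  have hθ : |2 * π * ξ * h| = 2 * π * |ξ| * h := by
    rw [abs_mul, abs_mul, abs_of_pos hh, abs_of_pos (by positivity : 0 < 2 * π)]
  have hθα : |2 * π * ξ * h| ^ α = (2 * π) ^ α * |ξ| ^ α * h ^ α := by
    rw [hθ, mul_rpow (by positivity) hh.le, mul_rpow (by positivity) (abs_nonneg _)]
  have hs := abs_genFun_sub_le hα1 hα2 (2 * π * ξ * h)
  rw [hθα, hθ] at hs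
  have hkey : |(2 * π) ^ α * |ξ| ^ α - 1 / h ^ α * genFun α (2 * π * ξ * h)| =
      1 / h ^ α * |genFun α (2 * π * ξ * h) - (2 * π) ^ α * |ξ| ^ α * h ^ α| := by
    rw [← abs_of_pos (one_div_pos.2 hha), ← abs_mul, abs_of_pos (one_div_pos.2 hha), abs_sub_comm]
    congr 1
    field_simp
  have hξ : |ξ| ^ α * |ξ| ^ 4 ≤ (1 + |ξ|) ^ (4 + α) := by
    rw [add_comm 4 α, rpow_add (by positivity : 0 < 1 + |ξ|)]
    have e : (1 + |ξ|) ^ (4 : ℝ) = (1 + |ξ|) ^ 4 := by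
      rw [← rpow_natCast]; norm_num
    rw [e]
    have : |ξ| ≤ 1 + |ξ| := by linarith
    gcongr
  have h2π : (2 * π) ^ (4 + α) = (2 * π) ^ 4 * (2 * π) ^ α := by
    rw [rpow_add (by positivity)]
    congr 1
    rw [← rpow_natCast]; norm_num
  rw [hkey]
  calc 1 / h ^ α * |genFun α (2 * π * ξ * h) - (2 * π) ^ α * |ξ| ^ α * h ^ α|
      ≤ 1 / h ^ α * (3 * ((2 * π) ^ α * |ξ| ^ α * h ^ α * (2 * π * |ξ| * h) ^ 4)) := by gcongr
    _ = 3 * (2 * π) ^ (4 + α) * h ^ 4 * (|ξ| ^ α * |ξ| ^ 4) := by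
        rw [h2π]; field_simp
    _ ≤ _ := by gcongr

section Line

variable {d : ℕ} (P : RieszProblem d)

theorem update_mem_Ω {x : Fin d → ℝ} (hx : x ∈ P.Ω) {i : Fin d} {s : ℝ} :
    Function.update x i s ∈ P.Ω ↔ s ∈ Set.Ioo (P.a i) (P.b i) := by
  simp only [Ω, Set.mem_univ_pi] at hx ⊢
  refine ⟨fun h => by simpa using h i, fun h j => ?_⟩
  rcases eq_or_ne j i with rfl | hj
  · simpa using h
  · simpa [Function.update_of_ne hj] using hx j

theorem continuous_lineExt {w : (Fin d → ℝ) → ℝ} (hw : ContinuousOn w (closure P.Ω))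
    (hb : ∀ x ∈ frontier P.Ω, w x = 0) (i : Fin d) (x : Fin d → ℝ) :
    Continuous (P.lineExt i w x) :=
  (continuous_indicator hb hw).comp (continuous_const.update i continuous_id)

theorem hasCompactSupport_lineExt (w : (Fin d → ℝ) → ℝ) (i : Fin d) {x : Fin d → ℝ}
    (hx : x ∈ P.Ω) : HasCompactSupport (P.lineExt i w x) := by
  refine HasCompactSupport.intro (isCompact_Icc (a := P.a i) (b := P.b i)) fun s hs => ?_
  refine Set.indicator_of_notMem (fun h => hs ?_) _
  exact Set.Ioo_subset_Icc_self ((P.update_mem_Ω hx).1 h)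

theorem rieszPotential_eq (w : (Fin d → ℝ) → ℝ) (i : Fin d) {x : Fin d → ℝ} (hx : x ∈ P.Ω) :
    P.rieszPotential i w x = fun s => ∫ η, P.lineExt i w x η * |s - η| ^ (-(P.α i - 1)) := by
  ext s
  rw [rieszPotential, intervalIntegral.integral_of_le (P.a_lt_b i).le, integral_Ioc_eq_integral_Ioo,
    ← integral_indicator measurableSet_Ioo]
  congr 1 with η
  by_cases hη : η ∈ Set.Ioo (P.a i) (P.b i)
  · rw [Set.indicator_of_mem hη, lineExt, Set.indicator_of_mem ((P.update_mem_Ω hx).2 hη),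
      rpow_neg (abs_nonneg _), div_eq_mul_inv]
  · rw [Set.indicator_of_notMem hη, lineExt,
      Set.indicator_of_notMem fun h => hη ((P.update_mem_Ω hx).1 h), zero_mul]

/-- On the Fourier side the Riesz derivative is multiplication by `-|2πξ| ^ α`. -/
theorem rieszDeriv_eq_fourier {w : (Fin d → ℝ) → ℝ} (hw : ContinuousOn w (closure P.Ω))
    (hb : ∀ x ∈ frontier P.Ω, w x = 0) (i : Fin d) {x : Fin d → ℝ} (hx : x ∈ P.Ω)
    (hreg : MemFracSobolev (4 + P.α i) (P.lineExt i w x)) :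
    P.rieszDeriv i w x = -((2 * π) ^ P.α i * (𝓕⁻ (fun ξ : ℝ =>
      ((|ξ| ^ P.α i : ℝ) : ℂ) * 𝓕 (fun y => (P.lineExt i w x y : ℂ)) ξ) (x i)).re) := by
  obtain ⟨h1, h2⟩ := P.α_mem i
  rw [rieszDeriv, P.rieszPotential_eq w i hx, deriv_deriv_integral_mul_abs_rpow (by linarith)
    (by linarith) (P.continuous_lineExt hw hb i x) (P.hasCompactSupport_lineExt w i hx)
    (by linarith) hreg.2]
  have h := gammaFactor_ratio h1 h2
  rw [show 1 - (P.α i - 1) = 2 - P.α i by ring, sub_add_cancel]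
  linear_combination (𝓕⁻ (fun ξ : ℝ =>
      ((|ξ| ^ P.α i : ℝ) : ℂ) * 𝓕 (fun y => (P.lineExt i w x y : ℂ)) ξ) (x i)).re * h

theorem node_update (n : Fin d → ℕ) (J : Fin d → ℤ) (i : Fin d) (j : ℤ) :
    P.node n (Function.update J i j) = Function.update (P.node n J) i (P.a i + j * P.h n i) := by
  ext l
  rcases eq_or_ne l i with rfl | hl
  · simp [node]
  · simp [node, Function.update_of_ne hl]

theorem h_pos (n : Fin d → ℕ) (i : Fin d) : 0 < P.h n i :=
  div_pos (sub_pos.2 (P.a_lt_b i)) (by positivity)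

/-- Consistency of the difference operator applied to the grid values of the zero extension. -/
theorem abs_fracDiff_sub_rieszDeriv_le {w : (Fin d → ℝ) → ℝ} (hw : ContinuousOn w (closure P.Ω))
    (hb : ∀ x ∈ frontier P.Ω, w x = 0) (n : Fin d → ℕ) (i : Fin d) {J : Fin d → ℤ}
    (hx : P.node n J ∈ P.Ω)
    (hreg : MemFracSobolev (4 + P.α i) (P.lineExt i w (P.node n J))) :
    |fracDiff (P.α i) (P.h n i) i (fun I => P.Ω.indicator w (P.node n I)) J -
        P.rieszDeriv i w (P.node n J)| ≤
      3 * (2 * π) ^ (4 + P.α i) * P.h n i ^ 4 *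
        ∫ η, fourierWeight (4 + P.α i) (P.lineExt i w (P.node n J)) η := by
  obtain ⟨h1, h2⟩ := P.α_mem i
  rw [P.rieszDeriv_eq_fourier hw hb i hx hreg, fracDiff]
  have e : ∀ k : ℤ, P.Ω.indicator w (P.node n (Function.update J i (J i - k))) =
      P.lineExt i w (P.node n J) (P.node n J i - k * P.h n i) := fun k => by
    rw [node_update, lineExt]
    congr 2
    simp only [node]
    push_cast
    ring
  simp_rw [e]
  exact abs_tsum_coeff_sub_le h1.le h2.le (P.continuous_lineExt hw hb i _) hreg.1 hreg.2
    (P.h_pos n i) _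

end Line

/-! ### Truncation error in time -/

/-- Symmetric second differences are of second order when the second derivative is bounded. -/
theorem abs_add_sub_two_mul_le {a b c s B : ℝ} {q q' q'' : ℝ → ℝ}
    (hq : ∀ x ∈ Set.Icc a b, HasDerivWithinAt q (q' x) (Set.Icc a b) x)
    (hq' : ∀ x ∈ Set.Icc a b, HasDerivWithinAt q' (q'' x) (Set.Icc a b) x)
    (hB : ∀ x ∈ Set.Icc a b, |q'' x| ≤ B) (hs : 0 ≤ s) (ha : a ≤ c - s) (hb : c + s ≤ b) :
    |q (c + s) + q (c - s) - 2 * q c| ≤ 2 * B * s ^ 2 := by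
  have hB0 : 0 ≤ B := (abs_nonneg _).trans (hB c ⟨by linarith, by linarith⟩)
  have hd : ∀ σ ∈ Set.Icc 0 s, HasDerivWithinAt (fun σ => q (c + σ) + q (c - σ))
      (q' (c + σ) - q' (c - σ)) (Set.Icc 0 s) σ := fun σ hσ => by
    have h₁ := (hq (c + σ) ⟨by linarith [hσ.1], by linarith [hσ.2]⟩).comp σ
      (((hasDerivAt_id' σ).const_add c).hasDerivWithinAt (s := Set.Icc 0 s))
      (fun x hx => ⟨by linarith [hx.1], by linarith [hx.2]⟩)
    have h₂ := (hq (c - σ) ⟨by linarith [hσ.2], by linarith [hσ.1]⟩).comp σ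
      (((hasDerivAt_id' σ).const_sub c).hasDerivWithinAt (s := Set.Icc 0 s))
      (fun x hx => ⟨by linarith [hx.2], by linarith [hx.1]⟩)
    exact (h₁.add h₂).congr_deriv (by ring)
  have hbd : ∀ σ ∈ Set.Icc 0 s, ‖q' (c + σ) - q' (c - σ)‖ ≤ 2 * B * s := fun σ hσ => by
    have := (convex_Icc a b).norm_image_sub_le_of_norm_hasDerivWithin_le hq' hB
      (x := c - σ) (y := c + σ) ⟨by linarith [hσ.2], by linarith [hσ.1]⟩
      ⟨by linarith [hσ.1], by linarith [hσ.2]⟩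
    refine this.trans ?_
    rw [norm_eq_abs, show c + σ - (c - σ) = 2 * σ by ring, abs_of_nonneg (by linarith [hσ.1])]
    nlinarith [hσ.2]
  have := (convex_Icc 0 s).norm_image_sub_le_of_norm_hasDerivWithin_le hd hbd
    (Set.left_mem_Icc.2 hs) (Set.right_mem_Icc.2 hs)
  simp only [norm_eq_abs, sub_zero, add_zero, abs_of_nonneg hs] at this
  calc _ = |q (c + s) + q (c - s) - (q c + q c)| := by congr 1; ring
    _ ≤ _ := this
    _ = _ := by ring

/-- Symmetric first differences are of second order when the third derivative is bounded. -/
theorem abs_sub_sub_two_mul_deriv_le {a b c s B : ℝ} {g g' g'' g''' : ℝ → ℝ}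
    (hg : ∀ x ∈ Set.Icc a b, HasDerivWithinAt g (g' x) (Set.Icc a b) x)
    (hg' : ∀ x ∈ Set.Icc a b, HasDerivWithinAt g' (g'' x) (Set.Icc a b) x)
    (hg'' : ∀ x ∈ Set.Icc a b, HasDerivWithinAt g'' (g''' x) (Set.Icc a b) x)
    (hB : ∀ x ∈ Set.Icc a b, |g''' x| ≤ B) (hs : 0 ≤ s) (ha : a ≤ c - s) (hb : c + s ≤ b) :
    |g (c + s) - g (c - s) - 2 * s * g' c| ≤ 2 * B * s ^ 3 := by
  have hB0 : 0 ≤ B := (abs_nonneg _).trans (hB c ⟨by linarith, by linarith⟩)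
  have hd : ∀ σ ∈ Set.Icc 0 s, HasDerivWithinAt (fun σ => g (c + σ) - g (c - σ) - 2 * σ * g' c)
      (g' (c + σ) + g' (c - σ) - 2 * g' c) (Set.Icc 0 s) σ := fun σ hσ => by
    have h₁ := (hg (c + σ) ⟨by linarith [hσ.1], by linarith [hσ.2]⟩).comp σ
      (((hasDerivAt_id' σ).const_add c).hasDerivWithinAt (s := Set.Icc 0 s))
      (fun x hx => ⟨by linarith [hx.1], by linarith [hx.2]⟩)
    have h₂ := (hg (c - σ) ⟨by linarith [hσ.2], by linarith [hσ.1]⟩).comp σ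
      (((hasDerivAt_id' σ).const_sub c).hasDerivWithinAt (s := Set.Icc 0 s))
      (fun x hx => ⟨by linarith [hx.2], by linarith [hx.1]⟩)
    have h₃ := ((((hasDerivAt_id' σ).const_mul 2).mul_const (g' c)).hasDerivWithinAt
      (s := Set.Icc 0 s))
    exact ((h₁.sub h₂).sub h₃).congr_deriv (by ring)
  have hbd : ∀ σ ∈ Set.Icc 0 s, ‖g' (c + σ) + g' (c - σ) - 2 * g' c‖ ≤ 2 * B * s ^ 2 :=
    fun σ hσ => by
      refine (abs_add_sub_two_mul_le hg' hg'' hB hσ.1 (by linarith [hσ.2])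
        (by linarith [hσ.2])).trans ?_
      have := pow_le_pow_left₀ hσ.1 hσ.2 2
      gcongr
  have := (convex_Icc 0 s).norm_image_sub_le_of_norm_hasDerivWithin_le hd hbd
    (Set.left_mem_Icc.2 hs) (Set.right_mem_Icc.2 hs)
  simp only [norm_eq_abs, sub_zero, add_zero, abs_of_nonneg hs] at this
  calc _ = |g (c + s) - g (c - s) - 2 * s * g' c - (g c - g c - 2 * 0 * g' c)| := by
        congr 1; ring
    _ ≤ _ := this
    _ = _ := by ring

theorem hasDerivWithinAt_iteratedDerivWithin {g : ℝ → ℝ} {a b : ℝ} (hab : a < b) {N k : ℕ}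
    (hg : ContDiffOn ℝ N g (Set.Icc a b)) (hk : k < N) {x : ℝ} (hx : x ∈ Set.Icc a b) :
    HasDerivWithinAt (iteratedDerivWithin k g (Set.Icc a b))
      (iteratedDerivWithin (k + 1) g (Set.Icc a b) x) (Set.Icc a b) x := by
  rw [iteratedDerivWithin_succ]
  exact (hg.differentiableOn_iteratedDerivWithin (by exact_mod_cast hk) (uniqueDiffOn_Icc hab)
    x hx).hasDerivWithinAt

/-- Averages over the end points of a time step are second-order accurate at its midpoint. -/
theorem abs_average_sub_le {q : ℝ → ℝ} {a b c s B : ℝ} (hab : a < b)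
    (hq : ContDiffOn ℝ 2 q (Set.Icc a b))
    (hB : ∀ x ∈ Set.Icc a b, |iteratedDerivWithin 2 q (Set.Icc a b) x| ≤ B)
    (hs : 0 ≤ s) (ha : a ≤ c - s) (hb : c + s ≤ b) :
    |q (c + s) + q (c - s) - 2 * q c| ≤ 2 * B * s ^ 2 := by
  have h := fun k (hk : k < 2) x (hx : x ∈ Set.Icc a b) =>
    hasDerivWithinAt_iteratedDerivWithin hab (N := 2) hq hk hx
  have := abs_add_sub_two_mul_le (h 0 (by norm_num)) (h 1 (by norm_num)) hB hs ha hb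
  simpa only [iteratedDerivWithin_zero] using this

theorem abs_sub_sub_derivWithin_le {g : ℝ → ℝ} {a b c s B : ℝ} (hab : a < b)
    (hg : ContDiffOn ℝ 3 g (Set.Icc a b))
    (hB : ∀ x ∈ Set.Icc a b, |iteratedDerivWithin 3 g (Set.Icc a b) x| ≤ B)
    (hs : 0 ≤ s) (ha : a ≤ c - s) (hb : c + s ≤ b) :
    |g (c + s) - g (c - s) - 2 * s * derivWithin g (Set.Icc a b) c| ≤ 2 * B * s ^ 3 := by
  have h := fun k (hk : k < 3) x (hx : x ∈ Set.Icc a b) =>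
    hasDerivWithinAt_iteratedDerivWithin hab (N := 3) hg hk hx
  have := abs_sub_sub_two_mul_deriv_le (h 0 (by norm_num)) (h 1 (by norm_num)) (h 2 (by norm_num))
    hB hs ha hb
  simpa only [iteratedDerivWithin_zero, zero_add, iteratedDerivWithin_one] using this

/-! ### The discrete energy -/

theorem mem_interiorIdx {d : ℕ} {n : Fin d → ℕ} {J : Fin d → ℤ} :
    J ∈ interiorIdx n ↔ ∀ i, J i ∈ Finset.Icc 1 (n i : ℤ) := Fintype.mem_piFinset

theorem update_mem_interiorIdx {d : ℕ} {n : Fin d → ℕ} {J : Fin d → ℤ} (hJ : J ∈ interiorIdx n)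
    {i : Fin d} {k : ℤ} :
    Function.update J i k ∈ interiorIdx n ↔ k ∈ Finset.Icc 1 (n i : ℤ) := by
  rw [mem_interiorIdx] at hJ ⊢
  refine ⟨fun h => by simpa using h i, fun h j => ?_⟩
  rcases eq_or_ne j i with rfl | hj
  · simpa using h
  · simpa only [Function.update_of_ne hj] using hJ j

/-- Sums over pairs of nodes on a common grid line are invariant under exchanging the two nodes. -/
theorem sum_sum_update_swap {d : ℕ} (n : Fin d → ℕ) (i : Fin d) (G : (Fin d → ℤ) → ℤ → ℝ) :
    ∑ J ∈ interiorIdx n, ∑ k ∈ Finset.Icc 1 (n i : ℤ), G J k =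
      ∑ J ∈ interiorIdx n, ∑ k ∈ Finset.Icc 1 (n i : ℤ), G (Function.update J i k) (J i) := by
  rw [← Finset.sum_product', ← Finset.sum_product']
  have hmem : ∀ p ∈ interiorIdx n ×ˢ Finset.Icc 1 (n i : ℤ),
      (Function.update p.1 i p.2, p.1 i) ∈ interiorIdx n ×ˢ Finset.Icc 1 (n i : ℤ) := by
    intro p hp
    rw [Finset.mem_product] at hp ⊢
    exact ⟨(update_mem_interiorIdx hp.1).2 hp.2, mem_interiorIdx.1 hp.1 i⟩
  refine Finset.sum_nbij' (fun p => (Function.update p.1 i p.2, p.1 i))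
    (fun p => (Function.update p.1 i p.2, p.1 i)) hmem hmem ?_ ?_ ?_ <;> simp

theorem sum_sum_update {d : ℕ} (n : Fin d → ℕ) (i : Fin d) (F : (Fin d → ℤ) → ℝ) :
    ∑ J ∈ interiorIdx n, ∑ k ∈ Finset.Icc 1 (n i : ℤ), F (Function.update J i k) =
      n i * ∑ J ∈ interiorIdx n, F J := by
  rw [sum_sum_update_swap]
  simp [Finset.mul_sum]

theorem fracDiff_eq_sum {d : ℕ} {n : Fin d → ℕ} (α h : ℝ) (i : Fin d) {v : (Fin d → ℤ) → ℝ}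
    (hv : ∀ J ∉ interiorIdx n, v J = 0) {J : Fin d → ℤ} (hJ : J ∈ interiorIdx n) :
    fracDiff α h i v J = -(1 / h ^ α) *
      ∑ k ∈ Finset.Icc 1 (n i : ℤ), coeff α (J i - k) * v (Function.update J i k) := by
  rw [fracDiff, ← (Equiv.subLeft (J i)).tsum_eq]
  simp only [Equiv.subLeft_apply, sub_sub_cancel]
  rw [tsum_eq_sum fun k hk => by
    rw [hv _ fun h => hk ((update_mem_interiorIdx hJ).1 h), mul_zero]]

/-- The symmetric bilinear form `(v, w) ↦ -⟨A v, w⟩` of the discrete spatial operator `A` on grid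
functions supported on the interior nodes. -/
noncomputable def energyForm {d : ℕ} (P : RieszProblem d) (n : Fin d → ℕ)
    (v w : (Fin d → ℤ) → ℝ) : ℝ :=
  ∑ i, P.K i * (1 / P.h n i ^ P.α i) * ∑ J ∈ interiorIdx n, ∑ k ∈ Finset.Icc 1 (n i : ℤ),
    coeff (P.α i) (J i - k) * v (Function.update J i k) * w J

section Energy

variable {d : ℕ} (P : RieszProblem d) (n : Fin d → ℕ)

theorem sum_fracDiff_mul {v : (Fin d → ℤ) → ℝ} (hv : ∀ J ∉ interiorIdx n, v J = 0)
    (w : (Fin d → ℤ) → ℝ) :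
    ∑ J ∈ interiorIdx n, (∑ i, P.K i * fracDiff (P.α i) (P.h n i) i v J) * w J =
      -P.energyForm n v w := by
  simp_rw [energyForm, Finset.sum_mul]
  rw [Finset.sum_comm, ← Finset.sum_neg_distrib]
  refine Finset.sum_congr rfl fun i _ => ?_
  rw [Finset.mul_sum, ← Finset.sum_neg_distrib]
  refine Finset.sum_congr rfl fun J hJ => ?_
  rw [fracDiff_eq_sum _ _ _ hv hJ, ← Finset.sum_mul]
  ring

theorem energyForm_comm (v w : (Fin d → ℤ) → ℝ) : P.energyForm n v w = P.energyForm n w v := by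
  refine Finset.sum_congr rfl fun i _ => ?_
  rw [sum_sum_update_swap]
  congr 1
  refine Finset.sum_congr rfl fun J _ => Finset.sum_congr rfl fun k _ => ?_
  rw [Function.update_idem, Function.update_self, Function.update_eq_self, ← coeff_neg, neg_sub]
  ring

theorem energyForm_average_sub (v w : (Fin d → ℤ) → ℝ) :
    P.energyForm n (fun J => (v J + w J) / 2) (fun J => v J - w J) =
      (P.energyForm n v v - P.energyForm n w w) / 2 := by
  have h : P.energyForm n (fun J => (v J + w J) / 2) (fun J => v J - w J) =
      (P.energyForm n v v - P.energyForm n v w + P.energyForm n w v - P.energyForm n w w) / 2 := by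
    simp only [energyForm, ← Finset.sum_sub_distrib, ← Finset.sum_add_distrib, Finset.sum_div]
    refine Finset.sum_congr rfl fun i _ => ?_
    simp only [Finset.mul_sum, ← Finset.sum_sub_distrib, ← Finset.sum_add_distrib, Finset.sum_div]
    refine Finset.sum_congr rfl fun J _ => Finset.sum_congr rfl fun k _ => ?_
    ring
  rw [h, P.energyForm_comm n w v]
  ring

/-- The part of the energy in one direction is an average of one-dimensional forms over grid
lines. -/
theorem directional_energy_eq (i : Fin d) (α : ℝ) (v : (Fin d → ℤ) → ℝ) :
    n i * ∑ J ∈ interiorIdx n, ∑ k ∈ Finset.Icc 1 (n i : ℤ),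
        coeff α (J i - k) * v (Function.update J i k) * v J =
      ∑ J ∈ interiorIdx n, ∑ j ∈ Finset.Icc 1 (n i : ℤ), ∑ k ∈ Finset.Icc 1 (n i : ℤ),
        coeff α (j - k) * v (Function.update J i k) * v (Function.update J i j) := by
  rw [← sum_sum_update]
  simp only [Function.update_idem, Function.update_self]

theorem directional_energy_nonneg (hn : ∀ i, 1 ≤ n i) (i : Fin d) {α : ℝ} (hα : 0 ≤ α)
    (v : (Fin d → ℤ) → ℝ) :
    0 ≤ ∑ J ∈ interiorIdx n, ∑ k ∈ Finset.Icc 1 (n i : ℤ),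
        coeff α (J i - k) * v (Function.update J i k) * v J := by
  have hni : (0 : ℝ) < n i := by exact_mod_cast hn i
  refine nonneg_of_mul_nonneg_right ?_ hni
  rw [directional_energy_eq]
  exact Finset.sum_nonneg fun J _ =>
    sum_coeff_mul_nonneg hα _ fun k => v (Function.update J i k)

theorem directional_energy_ge (hn : ∀ i, 1 ≤ n i) (i : Fin d) {α : ℝ} (hα : 0 ≤ α)
    (v : (Fin d → ℤ) → ℝ) :
    1 / 2 * (1 / (n i : ℝ)) ^ α * ∑ J ∈ interiorIdx n, v J ^ 2 ≤
      ∑ J ∈ interiorIdx n, ∑ k ∈ Finset.Icc 1 (n i : ℤ),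
        coeff α (J i - k) * v (Function.update J i k) * v J := by
  have hni : (0 : ℝ) < n i := by exact_mod_cast hn i
  refine le_of_mul_le_mul_left ?_ hni
  rw [directional_energy_eq, mul_left_comm, ← sum_sum_update, Finset.mul_sum]
  exact Finset.sum_le_sum fun J _ => half_sum_sq_le_sum_coeff hα (hn i) _ (by simp)
    fun k => v (Function.update J i k)

/-- The energy controls the `ℓ²`-norm uniformly in the mesh; one direction suffices. -/
theorem poincare_energyForm (hn : ∀ i, 1 ≤ n i) (i : Fin d) (v : (Fin d → ℤ) → ℝ) :
    P.K i / 2 * (1 / (P.b i - P.a i)) ^ P.α i * ∑ J ∈ interiorIdx n, v J ^ 2 ≤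
      P.energyForm n v v := by
  have hα : ∀ i, 0 ≤ P.α i := fun i => by linarith [(P.α_mem i).1]
  have hni : (0 : ℝ) < n i := by exact_mod_cast hn i
  have hL : 0 < P.b i - P.a i := sub_pos.2 (P.a_lt_b i)
  have hh := P.h_pos n i
  have hS : 0 ≤ ∑ J ∈ interiorIdx n, v J ^ 2 := Finset.sum_nonneg fun _ _ => sq_nonneg _
  have hK := (P.K_pos i).le
  have hterm : ∀ i, 0 ≤ P.K i * (1 / P.h n i ^ P.α i) * ∑ J ∈ interiorIdx n,
      ∑ k ∈ Finset.Icc 1 (n i : ℤ), coeff (P.α i) (J i - k) * v (Function.update J i k) * v J :=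
    fun i => mul_nonneg (mul_nonneg (P.K_pos i).le (one_div_nonneg.2
      (rpow_nonneg (P.h_pos n i).le _))) (directional_energy_nonneg n hn i (hα i) v)
  have hscale : (1 / (P.b i - P.a i)) ^ P.α i ≤
      (1 / P.h n i ^ P.α i) * (1 / (n i : ℝ)) ^ P.α i := by
    rw [← one_rpow (P.α i), ← div_rpow zero_le_one hh.le, one_rpow,
      ← mul_rpow (by positivity) (by positivity)]
    refine rpow_le_rpow (by positivity) ?_ (hα i)
    rw [one_div_mul_one_div]
    refine one_div_le_one_div_of_le (by positivity) ?_
    rw [h, div_mul_eq_mul_div, div_le_iff₀ (by positivity)]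
    nlinarith
  calc _ = P.K i * (1 / (P.b i - P.a i)) ^ P.α i * (1 / 2 * ∑ J ∈ interiorIdx n, v J ^ 2) := by
        ring
    _ ≤ P.K i * ((1 / P.h n i ^ P.α i) * (1 / (n i : ℝ)) ^ P.α i) *
          (1 / 2 * ∑ J ∈ interiorIdx n, v J ^ 2) := by gcongr
    _ = P.K i * (1 / P.h n i ^ P.α i) *
          (1 / 2 * (1 / (n i : ℝ)) ^ P.α i * ∑ J ∈ interiorIdx n, v J ^ 2) := by ring
    _ ≤ _ := mul_le_mul_of_nonneg_left (directional_energy_ge n hn i (hα i) v)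
          (mul_nonneg hK (one_div_nonneg.2 (rpow_nonneg hh.le _)))
    _ ≤ _ := Finset.single_le_sum (f := fun i => P.K i * (1 / P.h n i ^ P.α i) *
          ∑ J ∈ interiorIdx n, ∑ k ∈ Finset.Icc 1 (n i : ℤ),
            coeff (P.α i) (J i - k) * v (Function.update J i k) * v J)
          (fun i _ => hterm i) (Finset.mem_univ i)

/-- One step of the scheme. Testing with the increment `w - v` instead of the average `(w + v) / 2`
leaves the time-dependent weight `ρ` in a nonnegative term, so no regularity of `ρ` in time is
needed. -/
theorem energyForm_step_le {v w ρ τ : (Fin d → ℤ) → ℝ} {r₀ δ : ℝ} (hr₀ : 0 < r₀) (hδ : 0 < δ)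
    (hv : ∀ J ∉ interiorIdx n, v J = 0) (hw : ∀ J ∉ interiorIdx n, w J = 0)
    (hρ : ∀ J ∈ interiorIdx n, r₀ ≤ ρ J)
    (hstep : ∀ J ∈ interiorIdx n, ρ J * ((w J - v J) / δ) =
      (∑ i, P.K i * fracDiff (P.α i) (P.h n i) i (fun I => (w I + v I) / 2) J) - τ J) :
    P.energyForm n w w ≤
      P.energyForm n v v + δ / (2 * r₀) * ∑ J ∈ interiorIdx n, τ J ^ 2 := by
  have havg := P.sum_fracDiff_mul n (v := fun I => (w I + v I) / 2)
    (fun J hJ => by rw [hv J hJ, hw J hJ]; norm_num) (fun J => w J - v J)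
  rw [energyForm_average_sub] at havg
  have hpt : ∀ J ∈ interiorIdx n, -(δ / (4 * r₀) * τ J ^ 2) ≤
      (∑ i, P.K i * fracDiff (P.α i) (P.h n i) i (fun I => (w I + v I) / 2) J) * (w J - v J) := by
    intro J hJ
    have h1 := hstep J hJ
    have h2 : (∑ i, P.K i * fracDiff (P.α i) (P.h n i) i (fun I => (w I + v I) / 2) J) =
      ρ J * ((w J - v J) / δ) + τ J := by linarith
    rw [h2]
    set e := w J - v J
    have h3 : r₀ * (e ^ 2 / δ) ≤ ρ J * (e ^ 2 / δ) :=
      mul_le_mul_of_nonneg_right (hρ J hJ) (by positivity)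
    -- Completing the square absorbs the source term.
    have h4 : 0 ≤ r₀ / δ * (e + δ / (2 * r₀) * τ J) ^ 2 := by positivity
    have h5 : r₀ / δ * (e + δ / (2 * r₀) * τ J) ^ 2 =
        r₀ * (e ^ 2 / δ) + τ J * e + δ / (4 * r₀) * τ J ^ 2 := by
      field_simp; ring
    calc _ ≤ r₀ * (e ^ 2 / δ) + τ J * e := by linarith
      _ ≤ ρ J * (e ^ 2 / δ) + τ J * e := by linarith
      _ = _ := by ring
  have hsum := Finset.sum_le_sum hpt
  rw [havg, Finset.sum_neg_distrib, ← Finset.mul_sum] at hsum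
  have e : δ / (2 * r₀) * ∑ J ∈ interiorIdx n, τ J ^ 2 =
      2 * (δ / (4 * r₀) * ∑ J ∈ interiorIdx n, τ J ^ 2) := by field_simp; ring
  rw [e]
  linarith

end Energy

/-! ### Consistency and convergence of the scheme -/

variable {d : ℕ} (P : RieszProblem d)

theorem node_mem_Ω_iff (n : Fin d → ℕ) (J : Fin d → ℤ) :
    P.node n J ∈ P.Ω ↔ J ∈ interiorIdx n := by
  simp only [Ω, Set.mem_univ_pi, mem_interiorIdx]
  refine forall_congr' fun i => ?_
  have hh := P.h_pos n i
  have hL : P.b i = P.a i + ((n i : ℝ) + 1) * P.h n i := by rw [h]; field_simp; ring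
  rw [Set.mem_Ioo, Finset.mem_Icc, node, hL, lt_add_iff_pos_right, add_lt_add_iff_left,
    mul_pos_iff_of_pos_right hh, mul_lt_mul_iff_left₀ hh]
  have e1 : (0 : ℝ) < J i ↔ 1 ≤ J i := by rw [Int.cast_pos]; omega
  have e2 : (J i : ℝ) < n i + 1 ↔ J i ≤ n i := by
    rw [← Int.lt_add_one_iff]; exact_mod_cast Iff.rfl
  rw [e1, e2]

/-- The grid function of the zero extension of `w` to the whole space. -/
noncomputable def gridExt (n : Fin d → ℕ) (w : (Fin d → ℝ) → ℝ) (J : Fin d → ℤ) : ℝ :=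
  P.Ω.indicator w (P.node n J)

theorem gridExt_of_mem {n : Fin d → ℕ} (w : (Fin d → ℝ) → ℝ) {J : Fin d → ℤ}
    (hJ : J ∈ interiorIdx n) : P.gridExt n w J = w (P.node n J) :=
  Set.indicator_of_mem ((P.node_mem_Ω_iff n J).2 hJ) _

theorem gridExt_of_notMem {n : Fin d → ℕ} (w : (Fin d → ℝ) → ℝ) {J : Fin d → ℤ}
    (hJ : J ∉ interiorIdx n) : P.gridExt n w J = 0 :=
  Set.indicator_of_notMem (fun h => hJ ((P.node_mem_Ω_iff n J).1 h)) _

theorem fracDiff_average {n : Fin d → ℕ} (α h : ℝ) (i : Fin d) {v w : (Fin d → ℤ) → ℝ}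
    (hv : ∀ J ∉ interiorIdx n, v J = 0) (hw : ∀ J ∉ interiorIdx n, w J = 0) {J : Fin d → ℤ}
    (hJ : J ∈ interiorIdx n) :
    fracDiff α h i (fun I => (v I + w I) / 2) J =
      (fracDiff α h i v J + fracDiff α h i w J) / 2 := by
  rw [fracDiff_eq_sum α h i hv hJ, fracDiff_eq_sum α h i hw hJ, fracDiff_eq_sum α h i
    (fun J hJ => by rw [hv J hJ, hw J hJ]; norm_num) hJ, ← mul_add, ← Finset.sum_add_distrib,
    mul_div_assoc, Finset.sum_div]
  congr 1
  exact Finset.sum_congr rfl fun k _ => by ring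

theorem fracDiff_sub {n : Fin d → ℕ} (α h : ℝ) (i : Fin d) {v w : (Fin d → ℤ) → ℝ}
    (hv : ∀ J ∉ interiorIdx n, v J = 0) (hw : ∀ J ∉ interiorIdx n, w J = 0) {J : Fin d → ℤ}
    (hJ : J ∈ interiorIdx n) :
    fracDiff α h i (fun I => v I - w I) J = fracDiff α h i v J - fracDiff α h i w J := by
  rw [fracDiff_eq_sum α h i hv hJ, fracDiff_eq_sum α h i hw hJ, fracDiff_eq_sum α h i
    (fun J hJ => by rw [hv J hJ, hw J hJ]; norm_num) hJ, ← mul_sub, ← Finset.sum_sub_distrib]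
  congr 1
  exact Finset.sum_congr rfl fun k _ => by ring

theorem dt_pos {M : ℕ} (hM : 1 ≤ M) : 0 < P.dt M := by
  have : (0 : ℝ) < M := by exact_mod_cast hM
  exact div_pos P.T_pos this

theorem mul_dt {M : ℕ} (hM : 1 ≤ M) : (M : ℝ) * P.dt M = P.T := by
  have : (0 : ℝ) < M := by exact_mod_cast hM
  rw [dt]; field_simp

theorem abs_sum_fracDiff_gridExt_sub_spatialOp_le {w : (Fin d → ℝ) → ℝ}
    (hw : ContinuousOn w (closure P.Ω)) (hb : ∀ x ∈ frontier P.Ω, w x = 0) {B : ℝ}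
    (hreg : ∀ i, ∀ x ∈ P.Ω, MemFracSobolev (4 + P.α i) (P.lineExt i w x) ∧
      ∫ η, fourierWeight (4 + P.α i) (P.lineExt i w x) η ≤ B)
    (n : Fin d → ℕ) {J : Fin d → ℤ} (hJ : J ∈ interiorIdx n) :
    |∑ i, P.K i * fracDiff (P.α i) (P.h n i) i (P.gridExt n w) J - P.spatialOp w (P.node n J)| ≤
      (∑ i, P.K i * (3 * (2 * π) ^ (4 + P.α i) * |B|)) * ∑ i, P.h n i ^ 4 := by
  have hx := (P.node_mem_Ω_iff n J).2 hJ
  have hK := fun i => (P.K_pos i).le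
  have hh4 : ∀ i, 0 ≤ P.h n i ^ 4 := fun i => pow_nonneg (P.h_pos n i).le 4
  rw [spatialOp, ← Finset.sum_sub_distrib, Finset.sum_mul]
  refine (Finset.abs_sum_le_sum_abs _ _).trans (Finset.sum_le_sum fun i _ => ?_)
  rw [← mul_sub, abs_mul, abs_of_nonneg (hK i), mul_assoc]
  refine mul_le_mul_of_nonneg_left ?_ (hK i)
  have h1 := P.abs_fracDiff_sub_rieszDeriv_le hw hb n i hx (hreg i _ hx).1
  refine h1.trans ?_
  have h2 : ∫ η, fourierWeight (4 + P.α i) (P.lineExt i w (P.node n J)) η ≤ |B| :=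
    (hreg i _ hx).2.trans (le_abs_self B)
  have h3 : P.h n i ^ 4 ≤ ∑ i, P.h n i ^ 4 :=
    Finset.single_le_sum (fun i _ => hh4 i) (Finset.mem_univ i)
  have h4 := hh4 i
  calc _ ≤ 3 * (2 * π) ^ (4 + P.α i) * P.h n i ^ 4 * |B| := by gcongr
    _ ≤ 3 * (2 * π) ^ (4 + P.α i) * (∑ i, P.h n i ^ 4) * |B| := by gcongr
    _ = _ := by ring

/-- The residual of the exact solution in the scheme is of second order in time and of fourth order
in space. -/
theorem exists_truncation_bound {U : (Fin d → ℝ) → ℝ → ℝ} (hU : P.IsExactSolution U)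
    (hreg : P.IsRegular U) :
    ∃ C : ℝ, 0 ≤ C ∧ ∀ (n : Fin d → ℕ) (M : ℕ), 1 ≤ M → ∀ m < M, ∀ J ∈ interiorIdx n,
      |P.r (P.node n J) (((m : ℝ) + 1 / 2) * P.dt M) *
          ((P.gridExt n (fun y => U y (((m : ℝ) + 1) * P.dt M)) J -
            P.gridExt n (fun y => U y ((m : ℝ) * P.dt M)) J) / P.dt M) -
        ((∑ i, P.K i * fracDiff (P.α i) (P.h n i) i
            (fun I => (P.gridExt n (fun y => U y (((m : ℝ) + 1) * P.dt M)) I +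
              P.gridExt n (fun y => U y ((m : ℝ) * P.dt M)) I) / 2) J) +
          P.f (P.node n J) (((m : ℝ) + 1 / 2) * P.dt M))| ≤
        C * (P.dt M ^ 2 + ∑ i, P.h n i ^ 4) := by
  obtain ⟨B₁, hB₁⟩ := hreg.time
  obtain ⟨B₂, hB₂⟩ := hreg.time_spatialOp
  obtain ⟨B₃, hB₃⟩ := hreg.space
  set D := ∑ i, P.K i * (3 * (2 * π) ^ (4 + P.α i) * |B₃|) with hD
  have hD0 : 0 ≤ D := Finset.sum_nonneg fun i _ => mul_nonneg (P.K_pos i).le (by positivity)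
  refine ⟨|P.rmax| * |B₁| / 4 + |B₂| / 4 + D, by positivity, fun n M hM m hm J hJ => ?_⟩
  have hx := (P.node_mem_Ω_iff n J).2 hJ
  set x := P.node n J
  set δ := P.dt M with hδ
  have hδ0 : 0 < δ := P.dt_pos hM
  have hmM : (m : ℝ) + 1 ≤ M := by exact_mod_cast hm
  have hMT : (M : ℝ) * δ = P.T := P.mul_dt hM
  have hm0 : (0 : ℝ) ≤ m := Nat.cast_nonneg m
  set c := ((m : ℝ) + 1 / 2) * δ with hc
  have hc1 : ((m : ℝ) + 1) * δ = c + δ / 2 := by rw [hc]; ring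
  have hc0 : (m : ℝ) * δ = c - δ / 2 := by rw [hc]; ring
  have ha : 0 ≤ c - δ / 2 := by rw [← hc0]; positivity
  have hb : c + δ / 2 ≤ P.T := by rw [← hc1, ← hMT]; gcongr
  have hcI : c ∈ Set.Ioc 0 P.T := ⟨by linarith, by linarith⟩
  rw [hc1, hc0]
  have hI1 : c + δ / 2 ∈ Set.Icc 0 P.T := ⟨by linarith, hb⟩
  have hI0 : c - δ / 2 ∈ Set.Icc 0 P.T := ⟨ha, by linarith⟩
  rw [P.gridExt_of_mem _ hJ, P.gridExt_of_mem _ hJ]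
  set U₁ : (Fin d → ℝ) → ℝ := fun y => U y (c + δ / 2) with hU₁
  set U₀ : (Fin d → ℝ) → ℝ := fun y => U y (c - δ / 2) with hU₀
  have hspace : ∀ t ∈ Set.Icc 0 P.T,
      |∑ i, P.K i * fracDiff (P.α i) (P.h n i) i (P.gridExt n fun y => U y t) J -
        P.spatialOp (fun y => U y t) x| ≤ D * ∑ i, P.h n i ^ 4 := fun t ht =>
    P.abs_sum_fracDiff_gridExt_sub_spatialOp_le
      (hU.continuousOn.comp (f := fun y => (y, t)) (by fun_prop) fun y hy => ⟨hy, ht⟩)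
      (fun y hy => hU.boundary y hy t ht) (fun i y hy => hB₃ i y hy t ht) n hJ
  have s₁ : |∑ i, P.K i * fracDiff (P.α i) (P.h n i) i (P.gridExt n U₁) J -
        P.spatialOp U₁ x| ≤ D * ∑ i, P.h n i ^ 4 := hspace _ hI1
  have s₀ : |∑ i, P.K i * fracDiff (P.α i) (P.h n i) i (P.gridExt n U₀) J -
        P.spatialOp U₀ x| ≤ D * ∑ i, P.h n i ^ 4 := hspace _ hI0
  have havg : ∑ i, P.K i * fracDiff (P.α i) (P.h n i) i
        (fun I => (P.gridExt n U₁ I + P.gridExt n U₀ I) / 2) J =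
      (∑ i, P.K i * fracDiff (P.α i) (P.h n i) i (P.gridExt n U₁) J +
        ∑ i, P.K i * fracDiff (P.α i) (P.h n i) i (P.gridExt n U₀) J) / 2 := by
    rw [← Finset.sum_add_distrib, Finset.sum_div]
    refine Finset.sum_congr rfl fun i _ => ?_
    rw [fracDiff_average _ _ i (fun J hJ => P.gridExt_of_notMem _ hJ)
      (fun J hJ => P.gridExt_of_notMem _ hJ) hJ]
    ring
  have ht : |P.spatialOp U₁ x + P.spatialOp U₀ x - 2 * P.spatialOp (fun y => U y c) x| ≤
      2 * B₂ * (δ / 2) ^ 2 :=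
    abs_average_sub_le P.T_pos (hB₂ x hx).1 (hB₂ x hx).2 (by linarith) ha hb
  have hd : |U x (c + δ / 2) - U x (c - δ / 2) -
      2 * (δ / 2) * derivWithin (U x) (Set.Icc 0 P.T) c| ≤ 2 * B₁ * (δ / 2) ^ 3 :=
    abs_sub_sub_derivWithin_le P.T_pos (hB₁ x hx).1 (hB₁ x hx).2 (by linarith) ha hb
  have heq := hU.equation x hx c hcI
  obtain ⟨hr1, hr2⟩ := P.r_bounds x hx c hcI
  have hr : |P.r x c| ≤ |P.rmax| := abs_le_abs_of_nonneg (P.rmin_pos.le.trans hr1) hr2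
  set g := derivWithin (U x) (Set.Icc 0 P.T) c
  set A₁ := P.spatialOp U₁ x
  set A₀ := P.spatialOp U₀ x
  set A := P.spatialOp (fun y => U y c) x
  set F₁ := ∑ i, P.K i * fracDiff (P.α i) (P.h n i) i (P.gridExt n U₁) J
  set F₀ := ∑ i, P.K i * fracDiff (P.α i) (P.h n i) i (P.gridExt n U₀) J
  set H := ∑ i, P.h n i ^ 4 with hH
  have hH0 : 0 ≤ H := Finset.sum_nonneg fun i _ => pow_nonneg (P.h_pos n i).le 4
  have hd' : |P.r x c * ((U x (c + δ / 2) - U x (c - δ / 2)) / δ - g)| ≤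
      |P.rmax| * (|B₁| / 4 * δ ^ 2) := by
    rw [abs_mul]
    refine mul_le_mul hr ?_ (abs_nonneg _) (abs_nonneg _)
    rw [show (U x (c + δ / 2) - U x (c - δ / 2)) / δ - g =
      (U x (c + δ / 2) - U x (c - δ / 2) - 2 * (δ / 2) * g) / δ by field_simp, abs_div,
      abs_of_pos hδ0, div_le_iff₀ hδ0]
    refine hd.trans ?_
    calc 2 * B₁ * (δ / 2) ^ 3 ≤ 2 * |B₁| * (δ / 2) ^ 3 := by gcongr; exact le_abs_self _
      _ = _ := by ring
  have ht' : |A₁ + A₀ - 2 * A| ≤ |B₂| / 2 * δ ^ 2 := by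
    refine ht.trans ?_
    calc 2 * B₂ * (δ / 2) ^ 2 ≤ 2 * |B₂| * (δ / 2) ^ 2 := by gcongr; exact le_abs_self _
      _ = _ := by ring
  rw [havg]
  have hsplit : P.r x c * ((U₁ x - U₀ x) / δ) - ((F₁ + F₀) / 2 + P.f x c) =
      P.r x c * ((U x (c + δ / 2) - U x (c - δ / 2)) / δ - g) - (A₁ + A₀ - 2 * A) / 2 -
        ((F₁ - A₁) + (F₀ - A₀)) / 2 := by
    simp only [hU₁, hU₀]
    linear_combination heq
  rw [hsplit]
  obtain ⟨p₁, p₂⟩ := abs_le.1 hd'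
  obtain ⟨q₁, q₂⟩ := abs_le.1 ht'
  obtain ⟨u₁, u₂⟩ := abs_le.1 s₁
  obtain ⟨v₁, v₂⟩ := abs_le.1 s₀
  have hfin : |P.rmax| * (|B₁| / 4 * δ ^ 2) + |B₂| / 2 * δ ^ 2 / 2 + D * H ≤
      (|P.rmax| * |B₁| / 4 + |B₂| / 4 + D) * (δ ^ 2 + H) := by
    have : 0 ≤ (|P.rmax| * |B₁| / 4 + |B₂| / 4) * H + D * δ ^ 2 := by positivity
    linarith
  rw [abs_le]
  constructor <;> linarith

theorem prod_h_mul_card_le (n : Fin d → ℕ) :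
    (∏ i, P.h n i) * (interiorIdx n).card ≤ ∏ i, (P.b i - P.a i) := by
  have hcard : ((interiorIdx n).card : ℝ) = ∏ i, (n i : ℝ) := by
    simp [interiorIdx, Fintype.card_piFinset]
  rw [hcard, ← Finset.prod_mul_distrib]
  refine Finset.prod_le_prod (fun i _ => mul_nonneg (P.h_pos n i).le (Nat.cast_nonneg _))
    fun i _ => ?_
  have hL : 0 < P.b i - P.a i := sub_pos.2 (P.a_lt_b i)
  rw [h, div_mul_eq_mul_div, div_le_iff₀ (by positivity)]
  nlinarith

/-- Energy of the error: it vanishes initially and grows by at most the squared truncation error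
per unit of time. -/
theorem energyForm_error_le {U : (Fin d → ℝ) → ℝ → ℝ} (hU : P.IsExactSolution U)
    {n : Fin d → ℕ} {M : ℕ} (hM : 1 ≤ M) {u : ℕ → (Fin d → ℤ) → ℝ}
    (hu : P.IsSchemeSolution n M u) {ε : ℝ}
    (hε : ∀ m < M, ∀ J ∈ interiorIdx n,
      |P.r (P.node n J) (((m : ℝ) + 1 / 2) * P.dt M) *
          ((P.gridExt n (fun y => U y (((m : ℝ) + 1) * P.dt M)) J -
            P.gridExt n (fun y => U y ((m : ℝ) * P.dt M)) J) / P.dt M) -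
        ((∑ i, P.K i * fracDiff (P.α i) (P.h n i) i
            (fun I => (P.gridExt n (fun y => U y (((m : ℝ) + 1) * P.dt M)) I +
              P.gridExt n (fun y => U y ((m : ℝ) * P.dt M)) I) / 2) J) +
          P.f (P.node n J) (((m : ℝ) + 1 / 2) * P.dt M))| ≤ ε) :
    ∀ m ≤ M, P.energyForm n (fun J => u m J - P.gridExt n (fun y => U y ((m : ℝ) * P.dt M)) J)
        (fun J => u m J - P.gridExt n (fun y => U y ((m : ℝ) * P.dt M)) J) ≤
      m * (P.dt M / (2 * P.rmin) * ((interiorIdx n).card * ε ^ 2)) := by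
  have hδ0 := P.dt_pos hM
  have hzero : ∀ m ≤ M, ∀ J ∉ interiorIdx n,
      u m J - P.gridExt n (fun y => U y ((m : ℝ) * P.dt M)) J = 0 := fun m hm J hJ => by
    rw [hu.zero_ext m hm J hJ, P.gridExt_of_notMem _ hJ, sub_zero]
  intro m
  induction m with
  | zero =>
    intro _
    have h0 : (fun J => u 0 J - P.gridExt n (fun y => U y (((0 : ℕ) : ℝ) * P.dt M)) J) =
        fun _ => 0 := by
      funext J
      by_cases hJ : J ∈ interiorIdx n
      · rw [hu.initial J hJ, P.gridExt_of_mem _ hJ, Nat.cast_zero, zero_mul,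
          hU.initial _ ((P.node_mem_Ω_iff n J).2 hJ), sub_self]
      · exact hzero 0 (Nat.zero_le _) J hJ
    rw [h0]
    simp [energyForm]
  | succ m ih =>
    intro hm
    have hmM : m < M := hm
    have hih := ih hmM.le
    have hz1 := hzero (m + 1) hm
    have hz0 := hzero m hmM.le
    have hε := hε m hmM
    have hcast : ((m + 1 : ℕ) : ℝ) = (m : ℝ) + 1 := by push_cast; ring
    rw [hcast] at hz1 ⊢
    set c := ((m : ℝ) + 1 / 2) * P.dt M with hc
    set Z₁ := P.gridExt n (fun y => U y (((m : ℝ) + 1) * P.dt M)) with hZ₁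
    set Z₀ := P.gridExt n (fun y => U y ((m : ℝ) * P.dt M)) with hZ₀
    set τ : (Fin d → ℤ) → ℝ := fun J => P.r (P.node n J) c * ((Z₁ J - Z₀ J) / P.dt M) -
      ((∑ i, P.K i * fracDiff (P.α i) (P.h n i) i (fun I => (Z₁ I + Z₀ I) / 2) J) +
        P.f (P.node n J) c) with hτ
    have hcI : c ∈ Set.Ioc 0 P.T := by
      have h1 : (m : ℝ) + 1 ≤ M := by exact_mod_cast hm
      refine ⟨by positivity, ?_⟩
      rw [hc, ← P.mul_dt hM]
      gcongr
      linarith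
    have hZ₁z : ∀ J ∉ interiorIdx n, Z₁ J = 0 := fun J hJ => P.gridExt_of_notMem _ hJ
    have hZ₀z : ∀ J ∉ interiorIdx n, Z₀ J = 0 := fun J hJ => P.gridExt_of_notMem _ hJ
    have hstep : ∀ J ∈ interiorIdx n,
        P.r (P.node n J) c * (((u (m + 1) J - Z₁ J) - (u m J - Z₀ J)) / P.dt M) =
        (∑ i, P.K i * fracDiff (P.α i) (P.h n i) i
          (fun I => ((u (m + 1) I - Z₁ I) + (u m I - Z₀ I)) / 2) J) - τ J := by
      intro J hJ
      have hs := hu.step m hmM J hJ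
      have hlin : ∑ i, P.K i * fracDiff (P.α i) (P.h n i) i
          (fun I => ((u (m + 1) I - Z₁ I) + (u m I - Z₀ I)) / 2) J =
          ∑ i, P.K i * fracDiff (P.α i) (P.h n i) i (fun I => (u (m + 1) I + u m I) / 2) J -
          ∑ i, P.K i * fracDiff (P.α i) (P.h n i) i (fun I => (Z₁ I + Z₀ I) / 2) J := by
        rw [← Finset.sum_sub_distrib]
        refine Finset.sum_congr rfl fun i _ => ?_
        rw [← mul_sub, ← fracDiff_sub (n := n) _ _ i
          (fun J hJ => by rw [hu.zero_ext _ hm J hJ, hu.zero_ext _ hmM.le J hJ]; norm_num)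
          (fun J hJ => by rw [hZ₁z J hJ, hZ₀z J hJ]; norm_num) hJ]
        congr 2
        funext I
        ring
      rw [hlin, hτ]
      simp only
      rw [← hc] at hs
      linear_combination hs
    have hmain := P.energyForm_step_le n P.rmin_pos hδ0 hz0 hz1
      (fun J hJ => (P.r_bounds _ ((P.node_mem_Ω_iff n J).2 hJ) c hcI).1) hstep
    have hsum : ∑ J ∈ interiorIdx n, τ J ^ 2 ≤ (interiorIdx n).card * ε ^ 2 := by
      rw [← nsmul_eq_mul]
      refine Finset.sum_le_card_nsmul _ _ _ fun J hJ => ?_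
      rw [← sq_abs]
      exact pow_le_pow_left₀ (abs_nonneg _) (hε J hJ) 2
    have hr := P.rmin_pos
    have : P.dt M / (2 * P.rmin) * ∑ J ∈ interiorIdx n, τ J ^ 2 ≤
        P.dt M / (2 * P.rmin) * ((interiorIdx n).card * ε ^ 2) := by gcongr
    linarith

end RieszProblem

theorem theorem2 {d : ℕ} (P : RieszProblem d) (U : (Fin d → ℝ) → ℝ → ℝ)
    (hU : P.IsExactSolution U) (hreg : P.IsRegular U) :
    ∃ C₁ : ℝ, 0 < C₁ ∧
      ∀ (n : Fin d → ℕ) (M : ℕ), (∀ i, 1 ≤ n i) → 1 ≤ M →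
      ∀ u : ℕ → (Fin d → ℤ) → ℝ, P.IsSchemeSolution n M u →
      ∀ m < M,
        P.discreteNorm n
            (fun J => u (m + 1) J - U (P.node n J) (((m : ℝ) + 1) * P.dt M)) ≤
          C₁ * (P.dt M ^ 2 + ∑ i, P.h n i ^ 4) := by
  obtain ⟨C, hC0, hC⟩ := P.exists_truncation_bound hU hreg
  let i₀ : Fin d := ⟨0, P.dim_pos⟩
  set κ := P.K i₀ / 2 * (1 / (P.b i₀ - P.a i₀)) ^ P.α i₀ with hκ
  have hκ0 : 0 < κ := by
    have h1 := P.K_pos i₀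
    have h2 : 0 < P.b i₀ - P.a i₀ := sub_pos.2 (P.a_lt_b i₀)
    positivity
  set V := ∏ i, (P.b i - P.a i) with hV
  have hV0 : 0 ≤ V := Finset.prod_nonneg fun i _ => (sub_pos.2 (P.a_lt_b i)).le
  have hr := P.rmin_pos
  have hT := P.T_pos
  set G := V * (P.T / (2 * P.rmin)) / κ with hG
  have hG0 : 0 ≤ G := by positivity
  refine ⟨√G * C + 1, by positivity, fun n M hn hM u hu m hm => ?_⟩
  set e := P.dt M ^ 2 + ∑ i, P.h n i ^ 4 with he
  have he0 : 0 ≤ e := add_nonneg (sq_nonneg _)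
    (Finset.sum_nonneg fun i _ => pow_nonneg (P.h_pos n i).le 4)
  have henergy := P.energyForm_error_le hU hM hu (hC n M hM) (m + 1) hm
  have hpoin := (P.poincare_energyForm n hn i₀ _).trans henergy
  have hcast : ((m + 1 : ℕ) : ℝ) = (m : ℝ) + 1 := by push_cast; ring
  have hmT : ((m + 1 : ℕ) : ℝ) * P.dt M ≤ P.T := by
    rw [← P.mul_dt hM]
    have := (P.dt_pos hM).le
    gcongr
    exact hm
  have hsum : ∑ J ∈ RieszProblem.interiorIdx n,
      (u (m + 1) J - P.gridExt n (fun y => U y (((m + 1 : ℕ) : ℝ) * P.dt M)) J) ^ 2 =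
      ∑ J ∈ RieszProblem.interiorIdx n,
        (u (m + 1) J - U (P.node n J) (((m : ℝ) + 1) * P.dt M)) ^ 2 :=
    Finset.sum_congr rfl fun J hJ => by rw [P.gridExt_of_mem _ hJ, hcast]
  rw [hsum] at hpoin
  set S := ∑ J ∈ RieszProblem.interiorIdx n,
    (u (m + 1) J - U (P.node n J) (((m : ℝ) + 1) * P.dt M)) ^ 2
  set N : ℝ := ((RieszProblem.interiorIdx n).card : ℝ)
  have hN0 : 0 ≤ N := Nat.cast_nonneg _
  have hprod0 : 0 ≤ ∏ i, P.h n i := Finset.prod_nonneg fun i _ => (P.h_pos n i).le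
  have hprod : (∏ i, P.h n i) * N ≤ V := P.prod_h_mul_card_le n
  have hκS : κ * S ≤ P.T / (2 * P.rmin) * (N * (C * e) ^ 2) := by
    calc κ * S ≤ _ := hpoin
      _ = ((m + 1 : ℕ) : ℝ) * P.dt M / (2 * P.rmin) * (N * (C * e) ^ 2) := by ring
      _ ≤ _ := by gcongr
  have hnorm : (∏ i, P.h n i) * S ≤ G * (C * e) ^ 2 := by
    have h1 : S ≤ P.T / (2 * P.rmin) * (N * (C * e) ^ 2) / κ := by
      rw [le_div_iff₀ hκ0, mul_comm]; exact hκS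
    calc (∏ i, P.h n i) * S ≤ (∏ i, P.h n i) * (P.T / (2 * P.rmin) * (N * (C * e) ^ 2) / κ) := by
          gcongr
      _ = ((∏ i, P.h n i) * N) * (P.T / (2 * P.rmin)) / κ * (C * e) ^ 2 := by ring
      _ ≤ V * (P.T / (2 * P.rmin)) / κ * (C * e) ^ 2 := by gcongr
  calc P.discreteNorm n (fun J => u (m + 1) J - U (P.node n J) (((m : ℝ) + 1) * P.dt M))
      ≤ √(G * (C * e) ^ 2) := sqrt_le_sqrt hnorm
    _ = √G * (C * e) := by rw [sqrt_mul hG0, sqrt_sq (by positivity)]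
    _ ≤ (√G * C + 1) * e := by linarith
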